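/- Let $d\ge 3$, let $S\in\{1/2,1,3/2,\dots\}$, let $\beta>0$, and let $S_x^{(1)},S_x^{(2)},S_x^{(3)}$ ($x\in\mathbb Z^d$) be the spin-$S$ operators (the standard $(2S+1)\times(2S+1)$ spin matrices acting at site $x$). For a finite $\Gamma\subset\mathbb Z^d$ let $\mathfrak A_\Gamma=\bigotimes_{x\in\Gamma}M_{2S+1}(\mathbb C)$, embedded in $\mathfrak A_{\Gamma'}$ for $\Gamma\subset\Gamma'$ by $A\mapsto A\otimes 1$, and let $\mathfrak A$ be the quasi-local algebra, i.e. the operator-norm completion of $\bigcup_\Gamma\mathfrak A_\Gamma$. For $L\ge1$ let $\Lambda=\Lambda_L=\{-L+1,\dots,L\}^d$ and, for $B\in\mathbb R$, $$H^{(\Lambda)}(B)=\sum_{\{x,y\}\subset\Lambda,\ |x-y|=1}\mathbf S_x\cdot\mathbf S_y-B\,O^{(\Lambda)},\qquad O^{(\Lambda)}=\sum_{x\in\Lambda}(-1)^{x^{(1)}+\cdots+x^{(d)}}S_x^{(3)},$$ where the first sum is over nearest-neighbour pairs with periodic boundary conditions. Let $\langle A\rangle^{(\Lambda)}_{B,\beta}=\operatorname{Tr}(A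 e^{-\beta H^{(\Lambda)}(B)})/\operatorname{Tr}e^{-\beta H^{(\Lambda)}(B)}$. Let $B_n>0$ with $B_n\to0$. For each $n$ let $\rho_{B_n}$ be an infinite-volume equilibrium state, i.e. a continuous linear functional on $\mathfrak A$ which is the limit of $\langle\,\cdot\,\rangle^{(\Lambda_{L_k})}_{B_n,\beta}$ on all local observables along some sequence $L_k\to\infty$ (which may depend on $n$). Suppose that $\rho_{B_n}$ converges in the weak-$*$ topology to a functional $\rho_0$ on $\mathfrak A$, and let $$m_{\mathrm s,\beta}=\lim_{n\to\infty}\frac1{|\Lambda|}\rho_{B_n}(O^{(\Lambda)})$$ be the spontaneous magnetization, where $\Lambda=\Lambda_\ell$ for some $\ell\ge1$ (the value does not depend on $\ell$). If $m_{\mathrm s,\beta}\neq0$, then the transverse correlation function cannot decay rapidly: for every $x\in\mathbb Z^d$ it is not the case that $$|\rho_0(S_x^{(2)}S_y^{(2)})|=o\bigl(|x-y|^{-(d-2)}\bigr)\qquad\text{as }|x-y|\to\infty,\ y\in\mathbb Z^d,$$ where $|\cdot|$ is the Euclidean norm. -/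

import Mathlib

open Filter Topology Asymptotics
open scoped Kronecker

noncomputable section

namespace Heisenberg

/-! ### Spin matrices -/

/-- The raising operator `S⁺ = S⁽¹⁾ + i S⁽²⁾` for spin `S = N / 2` on `ℂ^(N+1)`, in the basis in
which the index `k = 0, …, N` labels the eigenvector of `S⁽³⁾` with eigenvalue `N / 2 - k`. -/
def spinRaise (N : ℕ) : Matrix (Fin (N + 1)) (Fin (N + 1)) ℂ :=
  Matrix.of fun a b =>
    if (a : ℕ) + 1 = (b : ℕ) then ((Real.sqrt (((a : ℝ) + 1) * ((N : ℝ) - (a : ℝ))) : ℝ) : ℂ) else 0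

/-- The spin matrices of magnitude `S = N / 2`; the components `S⁽¹⁾, S⁽²⁾, S⁽³⁾` are
`spin N 0`, `spin N 1`, `spin N 2`. -/
def spin (N : ℕ) : Fin 3 → Matrix (Fin (N + 1)) (Fin (N + 1)) ℂ :=
  ![(1 / 2 : ℂ) • (spinRaise N + (spinRaise N).conjTranspose),
    (1 / (2 * Complex.I) : ℂ) • (spinRaise N - (spinRaise N).conjTranspose),
    Matrix.diagonal fun k : Fin (N + 1) => (N : ℂ) / 2 - ((k : ℕ) : ℂ)]

/-! ### Local algebras -/

/-- The hypercubic lattice `ℤ^d`. -/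
abbrev Site (d : ℕ) : Type := Fin d → ℤ

/-- Labels of the product basis of `⨂_{x ∈ Γ} ℂ^(N+1)`. -/
abbrev Config (d N : ℕ) (Γ : Finset (Site d)) : Type := ↥Γ → Fin (N + 1)

/-- The algebra `𝔄_Γ = ⨂_{x ∈ Γ} M_{N+1}(ℂ)` of observables on `⨂_{x ∈ Γ} ℂ^(N+1)`, as matrices in
the product basis. -/
abbrev Obs (d N : ℕ) (Γ : Finset (Site d)) : Type := Matrix (Config d N Γ) (Config d N Γ) ℂ

variable {d N : ℕ}

/-- Splitting a configuration on `Γ₂ ⊇ Γ₁` into its parts on `Γ₁` and on `Γ₂ \ Γ₁`. -/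
def splitConfig {Γ₁ Γ₂ : Finset (Site d)} (h : Γ₁ ≤ Γ₂) :
    Config d N Γ₂ ≃ Config d N Γ₁ × Config d N (Γ₂ \ Γ₁) where
  toFun σ := (fun y => σ ⟨y.1, h y.2⟩, fun y => σ ⟨y.1, (Finset.mem_sdiff.1 y.2).1⟩)
  invFun p y := if hy : y.1 ∈ Γ₁ then p.1 ⟨y.1, hy⟩
    else p.2 ⟨y.1, Finset.mem_sdiff.2 ⟨y.2, hy⟩⟩
  left_inv σ := by
    funext y
    by_cases hy : y.1 ∈ Γ₁ <;> simp [hy]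
  right_inv p := by
    refine Prod.ext ?_ ?_
    · funext y
      simp
    · funext y
      have := (Finset.mem_sdiff.1 y.2).2
      simp [this]

/-- The embedding `𝔄_{Γ₁} → 𝔄_{Γ₂}`, `A ↦ A ⊗ 1_{Γ₂ \ Γ₁}`, for `Γ₁ ⊆ Γ₂`. -/
def embed {Γ₁ Γ₂ : Finset (Site d)} (h : Γ₁ ≤ Γ₂) : Obs d N Γ₁ →⋆ₐ[ℂ] Obs d N Γ₂ where
  toFun A := (A ⊗ₖ (1 : Obs d N (Γ₂ \ Γ₁))).submatrix (splitConfig h) (splitConfig h)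
  map_one' := by
    simp
  map_mul' A B := by
    rw [Matrix.submatrix_mul_equiv, ← Matrix.mul_kronecker_mul, Matrix.mul_one]
  map_zero' := by
    simp
  map_add' A B := by
    rw [Matrix.add_kronecker]
    rfl
  commutes' r := by
    ext σ τ
    simp only [Matrix.algebraMap_eq_diagonal, Matrix.submatrix_apply]
    by_cases hστ : σ = τ
    · subst hστ
      simp [Matrix.kroneckerMap_apply]
    · have h1 : splitConfig (N := N) h σ ≠ splitConfig h τ := fun e => hστ ((splitConfig h).injective e)
      simp only [Matrix.kroneckerMap_apply, Matrix.diagonal_apply, if_neg hστ]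
      by_cases h2 : (splitConfig (N := N) h σ).1 = (splitConfig h τ).1
      · have h3 : (splitConfig (N := N) h σ).2 ≠ (splitConfig h τ).2 := fun e => h1 (Prod.ext h2 e)
        simp [h3]
      · simp [h2]
  map_star' A := by
    simp only [Matrix.star_eq_conjTranspose]
    rw [Matrix.conjTranspose_submatrix, Matrix.conjTranspose_kronecker, Matrix.conjTranspose_one]

lemma embed_apply {Γ₁ Γ₂ : Finset (Site d)} (h : Γ₁ ≤ Γ₂) (A : Obs d N Γ₁) (σ τ : Config d N Γ₂) :
    embed h A σ τ = A (fun y => σ ⟨y.1, h y.2⟩) (fun y => τ ⟨y.1, h y.2⟩) *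
      if ∀ y : ↥Γ₂, y.1 ∉ Γ₁ → σ y = τ y then 1 else 0 := by
  change A (splitConfig h σ).1 (splitConfig h τ).1 *
    (1 : Obs d N (Γ₂ \ Γ₁)) (splitConfig h σ).2 (splitConfig h τ).2 = _
  rw [Matrix.one_apply]
  congr 1
  refine if_congr ?_ rfl rfl
  constructor
  · intro e y hy
    exact congrFun e ⟨y.1, Finset.mem_sdiff.2 ⟨y.2, hy⟩⟩
  · intro e
    funext y
    exact e ⟨y.1, (Finset.mem_sdiff.1 y.2).1⟩ (Finset.mem_sdiff.1 y.2).2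

lemma embed_injective {Γ₁ Γ₂ : Finset (Site d)} (h : Γ₁ ≤ Γ₂) :
    Function.Injective (embed (N := N) h) := by
  intro A B hAB
  ext σ τ
  have key : ∀ C : Obs d N Γ₁,
      embed h C ((splitConfig h).symm (σ, 0)) ((splitConfig h).symm (τ, 0)) = C σ τ := by
    intro C
    change (C ⊗ₖ (1 : Obs d N (Γ₂ \ Γ₁))) (splitConfig h ((splitConfig h).symm (σ, 0)))
      (splitConfig h ((splitConfig h).symm (τ, 0))) = _
    rw [Equiv.apply_symm_apply, Equiv.apply_symm_apply, Matrix.kroneckerMap_apply]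
    simp
  rw [← key A, ← key B, hAB]

instance instDirectedSystemObs : DirectedSystem (fun Γ : Finset (Site d) => Obs d N Γ)
    (fun _ _ h => embed (N := N) h) where
  map_self Γ A := by
    ext σ τ
    rw [embed_apply, if_pos (fun y hy => absurd y.2 hy), mul_one]
  map_map Γ₃ Γ₂ Γ₁ h₁₂ h₂₃ A := by
    ext σ τ
    simp only [embed_apply, mul_assoc]
    congr 1
    rw [ite_zero_mul_ite_zero, mul_one]
    refine if_congr ?_ rfl rfl
    constructor
    · rintro ⟨h1, h2⟩ y hy
      by_cases hy' : y.1 ∈ Γ₂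
      · exact h1 ⟨y.1, hy'⟩ hy
      · exact h2 y hy'
    · intro e
      exact ⟨fun y hy => e ⟨y.1, _⟩ hy, fun y hy => e y fun h => hy (h₁₂ h)⟩

/-- The local algebra `𝔄_loc = ⋃_Γ 𝔄_Γ`, the union over all finite `Γ ⊂ ℤ^d` along the embeddings
`A ↦ A ⊗ 1`. -/
def LocalAlgebra (d N : ℕ) : Type :=
  DirectLimit (fun Γ : Finset (Site d) => Obs d N Γ) (fun _ _ h => embed (N := N) h)

instance : Ring (LocalAlgebra d N) :=
  inferInstanceAs (Ring (DirectLimit (fun Γ : Finset (Site d) => Obs d N Γ)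
    (fun _ _ h => embed (N := N) h)))

instance : Algebra ℂ (LocalAlgebra d N) :=
  inferInstanceAs (Algebra ℂ (DirectLimit (fun Γ : Finset (Site d) => Obs d N Γ)
    (fun _ _ h => embed (N := N) h)))

/-- The inclusion of `𝔄_Γ` into the local algebra. -/
def localIncl (Γ : Finset (Site d)) : Obs d N Γ →ₐ[ℂ] LocalAlgebra d N where
  toFun A := (⟦⟨Γ, A⟩⟧ : DirectLimit (fun Γ : Finset (Site d) => Obs d N Γ)
    (fun _ _ h => embed (N := N) h))
  map_one' := (DirectLimit.one_def Γ).symm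
  map_mul' A B := (DirectLimit.mul_def Γ A B).symm
  map_zero' := (DirectLimit.zero_def Γ).symm
  map_add' A B := (DirectLimit.add_def Γ A B).symm
  commutes' c := (DirectLimit.algebraMap_def Γ c).symm

lemma localIncl_embed {Γ₁ Γ₂ : Finset (Site d)} (h : Γ₁ ≤ Γ₂) (A : Obs d N Γ₁) :
    localIncl Γ₂ (embed h A) = localIncl Γ₁ A :=
  (DirectLimit.eq_of_le (f := fun _ _ h => embed (N := N) h)
    (⟨Γ₁, A⟩ : Σ Γ : Finset (Site d), Obs d N Γ) Γ₂ h).symm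

lemma exists_localIncl (a : LocalAlgebra d N) : ∃ Γ A, a = localIncl Γ A :=
  DirectLimit.exists_eq_mk _ a

lemma exists_localIncl₂ (a b : LocalAlgebra d N) :
    ∃ Γ A B, a = localIncl Γ A ∧ b = localIncl Γ B :=
  DirectLimit.exists_eq_mk₂ _ a b

section Norm

open scoped Matrix.Norms.L2Operator

lemma norm_embed {Γ₁ Γ₂ : Finset (Site d)} (h : Γ₁ ≤ Γ₂) (A : Obs d N Γ₁) :
    ‖embed h A‖ = ‖A‖ :=
  NonUnitalStarAlgHom.norm_map (embed h) (embed_injective h) A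

/-- The norm of a local observable is its operator norm as an operator on the Hilbert space of
any finite region in which it is localized. -/
def localNorm : LocalAlgebra d N → ℝ :=
  DirectLimit.lift (fun _ _ h => embed (N := N) h) (fun _ A => ‖A‖)
    (fun _ _ h A => (norm_embed h A).symm)

lemma localNorm_localIncl (Γ : Finset (Site d)) (A : Obs d N Γ) :
    localNorm (localIncl Γ A) = ‖A‖ := rfl

instance : NormedRing (LocalAlgebra d N) where
  __ := (inferInstance : Ring (LocalAlgebra d N))
  __ := AddGroupNorm.toNormedAddCommGroup (E := LocalAlgebra d N)
    { toFun := localNorm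
      map_zero' := by
        rw [← map_zero (localIncl ∅), localNorm_localIncl, norm_zero]
      add_le' := fun a b => by
        obtain ⟨Γ, A, B, rfl, rfl⟩ := exists_localIncl₂ a b
        rw [← map_add]
        exact norm_add_le A B
      neg' := fun a => by
        obtain ⟨Γ, A, rfl⟩ := exists_localIncl a
        rw [← map_neg]
        exact norm_neg A
      eq_zero_of_map_eq_zero' := fun a h => by
        obtain ⟨Γ, A, rfl⟩ := exists_localIncl a
        rw [norm_eq_zero.1 (show ‖A‖ = 0 from h), map_zero] }
  norm_mul_le := fun a b => by
    obtain ⟨Γ, A, B, rfl, rfl⟩ := exists_localIncl₂ a b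
    rw [← map_mul]
    exact norm_mul_le A B

lemma norm_localIncl (Γ : Finset (Site d)) (A : Obs d N Γ) : ‖localIncl Γ A‖ = ‖A‖ := rfl

instance : NormedAlgebra ℂ (LocalAlgebra d N) where
  norm_smul_le := fun c a => by
    obtain ⟨Γ, A, rfl⟩ := exists_localIncl a
    rw [← map_smul, norm_localIncl, norm_localIncl]
    exact norm_smul_le c A

end Norm

/-- The quasi-local algebra: the completion of the local algebra in the operator norm. -/
abbrev QuasiLocalAlgebra (d N : ℕ) : Type := UniformSpace.Completion (LocalAlgebra d N)

/-- The inclusion of `𝔄_Γ` into the quasi-local algebra. -/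
def incl (Γ : Finset (Site d)) : Obs d N Γ →ₐ[ℂ] QuasiLocalAlgebra d N where
  toFun A := ((localIncl Γ A : LocalAlgebra d N) : QuasiLocalAlgebra d N)
  map_one' := by rw [map_one, UniformSpace.Completion.coe_one]
  map_mul' A B := by rw [map_mul, UniformSpace.Completion.coe_mul]
  map_zero' := by rw [map_zero, UniformSpace.Completion.coe_zero]
  map_add' A B := by rw [map_add, UniformSpace.Completion.coe_add]
  commutes' c := by rw [AlgHom.commutes, UniformSpace.Completion.algebraMap_def]

lemma incl_embed {Γ₁ Γ₂ : Finset (Site d)} (h : Γ₁ ≤ Γ₂) (A : Obs d N Γ₁) :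
    incl Γ₂ (embed h A) = incl Γ₁ A :=
  congrArg (fun a : LocalAlgebra d N => (a : QuasiLocalAlgebra d N)) (localIncl_embed h A)

/-! ### Spin operators -/

/-- The matrix `M` as an observable in `𝔄_{x}`. -/
def oneSite (x : Site d) (M : Matrix (Fin (N + 1)) (Fin (N + 1)) ℂ) : Obs d N {x} :=
  M.submatrix (fun σ => σ ⟨x, Finset.mem_singleton_self x⟩)
    (fun σ => σ ⟨x, Finset.mem_singleton_self x⟩)

/-- The spin operator `S_x^{(j+1)}` (`j = 0, 1, 2`) as an element of `𝔄_Γ`, for `x ∈ Γ`. -/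
def spinAt {Γ : Finset (Site d)} (x : ↥Γ) (j : Fin 3) : Obs d N Γ :=
  embed (Finset.singleton_subset_iff.2 x.2) (oneSite x.1 (spin N j))

/-- The spin operator `S_x^{(j+1)}` (`j = 0, 1, 2`) as an element of the quasi-local algebra. -/
def spinOp (N : ℕ) (x : Site d) (j : Fin 3) : QuasiLocalAlgebra d N :=
  incl {x} (oneSite x (spin N j))

/-! ### The antiferromagnet on the periodic box -/

/-- The box `Λ_L = {-L+1, …, L}^d`. -/
def box (d L : ℕ) : Finset (Site d) :=
  Fintype.piFinset fun _ => Finset.Icc (-(L : ℤ) + 1) (L : ℤ)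

/-- Two sites of `Λ_L` are nearest neighbours for the periodic boundary condition: they differ by
`±1` modulo `2 L` in one coordinate and agree in all the others. -/
def PeriodicNeighbor (L : ℕ) (x y : Site d) : Prop :=
  ∃ i : Fin d, (∀ k, k ≠ i → x k = y k) ∧
    ((2 * (L : ℤ)) ∣ x i - y i - 1 ∨ (2 * (L : ℤ)) ∣ x i - y i + 1)

/-- The sign `(-1)^{x^{(1)} + ⋯ + x^{(d)}}`. -/
def stagger (x : Site d) : ℂ := (-1 : ℂ) ^ (∑ i, x i)

open Classical in
/-- The Hamiltonian `H_0` of the antiferromagnet on `Λ_L` with periodic boundary condition: the sum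
of `𝐒_x · 𝐒_y` over unordered nearest-neighbour pairs, written as half the sum over ordered pairs
(`𝐒_x` and `𝐒_y` commute). -/
def hamiltonianZero (d N L : ℕ) : Obs d N (box d L) :=
  (1 / 2 : ℂ) • ∑ x : ↥(box d L), ∑ y : ↥(box d L),
    if PeriodicNeighbor L x.1 y.1 then ∑ j : Fin 3, spinAt x j * spinAt y j else 0

/-- The order parameter `O = ∑_{x ∈ Λ_L} (-1)^{x^{(1)} + ⋯ + x^{(d)}} S_x^{(3)}` in `𝔄_{Λ_L}`. -/
def orderParameter (d N L : ℕ) : Obs d N (box d L) :=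
  ∑ x : ↥(box d L), stagger x.1 • spinAt x 2

/-- The Hamiltonian `H(B) = H_0 - B O` in the staggered field `B`. -/
def hamiltonian (d N L : ℕ) (B : ℝ) : Obs d N (box d L) :=
  hamiltonianZero d N L - (B : ℂ) • orderParameter d N L

/-- The Gibbs expectation `Tr (A e^{-β H(B)}) / Tr e^{-β H(B)}` on `Λ_L`. -/
def gibbs (L : ℕ) (β B : ℝ) (A : Obs d N (box d L)) : ℂ :=
  (A * NormedSpace.exp (-(β : ℂ) • hamiltonian d N L B)).trace /
    (NormedSpace.exp (-(β : ℂ) • hamiltonian d N L B)).trace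

open Classical in
/-- The Gibbs expectation on `Λ_L` of an observable of `𝔄_Γ`, for `Γ ⊆ Λ_L` (and `0` otherwise). -/
def gibbsLocal (L : ℕ) (β B : ℝ) (Γ : Finset (Site d)) (A : Obs d N Γ) : ℂ :=
  if h : Γ ≤ box d L then gibbs L β B (embed h A) else 0

/-! ### Infinite-volume states -/

/-- `ρ` is an infinite-volume equilibrium state `ρ_B` at inverse temperature `β`: the weak-* limit
of the Gibbs expectations along some sequence of boxes `Λ_{L_k}` growing to `ℤ^d`. -/
def IsEquilibriumState (β B : ℝ) (ρ : WeakDual ℂ (QuasiLocalAlgebra d N)) : Prop :=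
  ∃ L : ℕ → ℕ, Tendsto L atTop atTop ∧ ∀ (Γ : Finset (Site d)) (A : Obs d N Γ),
    Tendsto (fun k => gibbsLocal (L k) β B Γ A) atTop (𝓝 (ρ (incl Γ A)))

/-- The staggered magnetization per site, `ρ(O^{(Λ_ℓ)}) / |Λ_ℓ|`. -/
def magnetization (ℓ : ℕ) (ρ : WeakDual ℂ (QuasiLocalAlgebra d N)) : ℂ :=
  ρ (incl (box d ℓ) (orderParameter d N ℓ)) / ((box d ℓ).card : ℂ)

/-- The Euclidean distance `|x - y|` on `ℤ^d`. -/
def siteDist (x y : Site d) : ℝ := Real.sqrt (∑ i, ((x i : ℝ) - (y i : ℝ)) ^ 2)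

end Heisenberg

end

/-! Mermin–Wagner argument run backwards, at length scale `R`. A slow local rotation about the first
axis, generated by `C = ∑ g(x) S_x^{(1)}` with `g = cutoff R` equal to 1 on the box of size `R`,
turns the transverse staggered magnetization `A = ∑ (-1)^x S_x^{(2)}` of that box into its order
parameter: `[C, A] = i O`. The inequality `bogoliubov` therefore bounds `|⟨O⟩|²` by `⟨A²⟩` times the
expectation of `[C, [H, C]]`.

Each bond is invariant under rotating both its spins, so in the double commutator
(`comm_comm_exchange`) it contributes only `(g(x) - g(y))²`. These terms add up to `O(R^{d-2})`, and
the staggered field adds `O(B R^d)`. All constants are uniform in the volume, so `L → ∞` and then `B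
→ 0` leave `R^{2d} |m|² ≤ const · R^{d-2} · ρ₀(A²)`.

Translations, combined with a spin flip for odd shifts, preserve the Hamiltonian
(`obsShift_hamiltonian`). Hence `ρ₀(A²)` is at most `(2R)^d` times the sum of the absolute
correlations over displacements of size at most `2R` (`transverse_sq_re_le`). Decay
`o(|w|^{-(d-2)})` would make this sum `o(R²)` by `sum_cube_le_of_decay`. Then `R² |m|² ≤ o(R²)`,
which forces `m = 0`. -/

noncomputable section

namespace Heisenberg

variable {d N : ℕ}

/-! ### Finite-dimensional Gibbs states and the Bogoliubov inequality. -/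

section Bogoliubov

variable {n : Type*} [Fintype n] [DecidableEq n]

/-- The thermal expectation `Tr (X e^{-β H}) / Tr e^{-β H}`. -/
def thermal (H : Matrix n n ℂ) (β : ℝ) (X : Matrix n n ℂ) : ℂ :=
  (X * NormedSpace.exp (-(β : ℂ) • H)).trace / (NormedSpace.exp (-(β : ℂ) • H)).trace

/-- The matrix of `X` in the eigenbasis of `H`. -/
def inEigenbasis {H : Matrix n n ℂ} (hH : H.IsHermitian) : Matrix n n ℂ →⋆ₐ[ℂ] Matrix n n ℂ :=
  (Unitary.conjStarAlgAut ℂ (Matrix n n ℂ) (star hH.eigenvectorUnitary) : _ →⋆ₐ[ℂ] _)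

lemma inEigenbasis_apply {H : Matrix n n ℂ} (hH : H.IsHermitian) (X : Matrix n n ℂ) :
    inEigenbasis hH X =
      star (hH.eigenvectorUnitary : Matrix n n ℂ) * X * (hH.eigenvectorUnitary : Matrix n n ℂ) := by
  simp [inEigenbasis, Unitary.conjStarAlgAut_apply]

lemma inEigenbasis_self {H : Matrix n n ℂ} (hH : H.IsHermitian) :
    inEigenbasis hH H = Matrix.diagonal fun i => (hH.eigenvalues i : ℂ) := by
  have h := hH.conjStarAlgAut_star_eigenvectorUnitary
  rw [Unitary.conjStarAlgAut_star_apply] at h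
  rw [inEigenbasis_apply, h]
  rfl

lemma exp_eq_conj {H : Matrix n n ℂ} (hH : H.IsHermitian) (β : ℝ) :
    NormedSpace.exp (-(β : ℂ) • H) = (hH.eigenvectorUnitary : Matrix n n ℂ) *
      Matrix.diagonal (fun i => ((Real.exp (-β * hH.eigenvalues i) : ℝ) : ℂ)) *
      star (hH.eigenvectorUnitary : Matrix n n ℂ) := by
  set U : Matrix n n ℂ := (hH.eigenvectorUnitary : Matrix n n ℂ) with hU
  have h1 : star U * U = 1 := Unitary.coe_star_mul_self hH.eigenvectorUnitary
  have h2 : U * star U = 1 := Unitary.coe_mul_star_self hH.eigenvectorUnitary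
  have hinv : U⁻¹ = star U := Matrix.inv_eq_left_inv h1
  have hunit : IsUnit U := ⟨⟨U, star U, h2, h1⟩, rfl⟩
  have hs := hH.spectral_theorem
  rw [Unitary.conjStarAlgAut_apply] at hs
  have : -(β : ℂ) • H = U * Matrix.diagonal (fun i => (((-β * hH.eigenvalues i : ℝ)) : ℂ)) * U⁻¹ := by
    rw [hinv]
    conv_lhs => rw [hs]
    rw [← Matrix.smul_mul, ← Matrix.mul_smul]
    congr 2
    ext i j
    by_cases hij : i = j
    · subst hij; simp
    · simp [hij]
  rw [this, Matrix.exp_conj _ _ hunit, Matrix.exp_diagonal, hinv]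
  congr 3
  funext i
  rw [Pi.exp_def, Complex.ofReal_exp, Complex.exp_eq_exp_ℂ]

lemma trace_mul_exp {H : Matrix n n ℂ} (hH : H.IsHermitian) (β : ℝ) (X : Matrix n n ℂ) :
    (X * NormedSpace.exp (-(β : ℂ) • H)).trace =
      ∑ i, inEigenbasis hH X i i * ((Real.exp (-β * hH.eigenvalues i) : ℝ) : ℂ) := by
  rw [exp_eq_conj hH, inEigenbasis_apply, ← mul_assoc, Matrix.trace_mul_comm, ← mul_assoc, ← mul_assoc]
  simp [Matrix.trace, Matrix.mul_diagonal]

/-- The Gibbs weights. -/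
def weight {H : Matrix n n ℂ} (hH : H.IsHermitian) (β : ℝ) (i : n) : ℝ :=
  Real.exp (-β * hH.eigenvalues i) / ∑ j, Real.exp (-β * hH.eigenvalues j)

lemma weight_nonneg {H : Matrix n n ℂ} (hH : H.IsHermitian) (β : ℝ) (i : n) : 0 ≤ weight hH β i := by
  unfold weight; positivity

/-- An inequality instead of an equality, so that an empty index type needs no separate treatment.
-/
lemma sum_weight_le_one {H : Matrix n n ℂ} (hH : H.IsHermitian) (β : ℝ) :
    ∑ i, weight hH β i ≤ 1 := by
  simp only [weight, ← Finset.sum_div]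
  exact div_self_le_one _

lemma thermal_eq_sum {H : Matrix n n ℂ} (hH : H.IsHermitian) (β : ℝ) (X : Matrix n n ℂ) :
    thermal H β X = ∑ i, inEigenbasis hH X i i * (weight hH β i : ℂ) := by
  have hZ : (NormedSpace.exp (-(β : ℂ) • H)).trace =
      ((∑ j, Real.exp (-β * hH.eigenvalues j) : ℝ) : ℂ) := by
    have := trace_mul_exp hH β 1
    rw [one_mul, map_one] at this
    rw [this]
    simp
  rw [thermal, trace_mul_exp hH, hZ, Finset.sum_div]
  refine Finset.sum_congr rfl fun i _ => ?_
  rw [weight, Complex.ofReal_div, mul_div_assoc]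

/-- From `1 + t ≤ exp t`: for `a ≤ b`, `e^{-βa} - e^{-βb} ≤ β (b - a) e^{-βa}`. Using `tanh` would
gain a factor 2, which is not needed. -/
lemma sq_weight_sub_le {H : Matrix n n ℂ} (hH : H.IsHermitian) {β : ℝ} (hβ : 0 ≤ β) (i j : n) :
    (weight hH β i - weight hH β j) ^ 2 ≤
      ((weight hH β i - weight hH β j) * (hH.eigenvalues j - hH.eigenvalues i)) *
        (β * (weight hH β i + weight hH β j)) := by
  have key : ∀ a b : ℝ, a ≤ b → 0 ≤ Real.exp (-β * a) - Real.exp (-β * b) ∧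
      Real.exp (-β * a) - Real.exp (-β * b) ≤ (b - a) * (β * (Real.exp (-β * a) + Real.exp (-β * b))) := by
    intro a b hab
    constructor
    · rw [sub_nonneg, Real.exp_le_exp]; nlinarith
    · have h := Real.add_one_le_exp (-β * b - -β * a)
      rw [Real.exp_sub, le_div_iff₀ (Real.exp_pos _)] at h
      have h3 : 0 ≤ (b - a) * (β * Real.exp (-β * b)) :=
        mul_nonneg (sub_nonneg.2 hab) (mul_nonneg hβ (Real.exp_pos _).le)
      nlinarith
  set Z := ∑ k, Real.exp (-β * hH.eigenvalues k) with hZ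
  have hZ0 : 0 ≤ Z := Finset.sum_nonneg fun k _ => (Real.exp_pos _).le
  have hw : ∀ k, weight hH β k = Real.exp (-β * hH.eigenvalues k) / Z := fun k => rfl
  rw [hw, hw]
  rw [← sub_div, ← add_div]
  have : ∀ p q r : ℝ, p ^ 2 ≤ (p * r) * (β * q) → (p / Z) ^ 2 ≤ (p / Z * r) * (β * (q / Z)) := by
    intro p q r h
    rw [div_pow, show (p / Z * r) * (β * (q / Z)) = (p * r) * (β * q) / Z ^ 2 by ring]
    exact div_le_div_of_nonneg_right h (by positivity)
  apply this
  rcases le_total (hH.eigenvalues i) (hH.eigenvalues j) with h | h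
  · obtain ⟨h1, h2⟩ := key _ _ h
    nlinarith
  · obtain ⟨h1, h2⟩ := key _ _ h
    nlinarith

/-- Swapping the summation indices in the second product moves its weight to the other index, so
only differences of weights remain. -/
lemma thermal_comm {H : Matrix n n ℂ} (hH : H.IsHermitian) (β : ℝ) (C A : Matrix n n ℂ) :
    thermal H β (C * A - A * C) = ∑ i, ∑ j, ((weight hH β i - weight hH β j : ℝ) : ℂ) *
      (inEigenbasis hH C i j * inEigenbasis hH A j i) := by
  rw [thermal_eq_sum hH]
  simp only [map_sub, map_mul, Matrix.sub_apply, Matrix.mul_apply, sub_mul, Finset.sum_mul,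
    Finset.sum_sub_distrib, Complex.ofReal_sub]
  congr 1
  · exact Finset.sum_congr rfl fun i _ => Finset.sum_congr rfl fun j _ => by ring
  · rw [Finset.sum_comm]
    exact Finset.sum_congr rfl fun i _ => Finset.sum_congr rfl fun j _ => by ring

lemma inEigenbasis_symm_apply {H : Matrix n n ℂ} (hH : H.IsHermitian) {A : Matrix n n ℂ}
    (hA : A.IsHermitian) (i j : n) : inEigenbasis hH A j i = star (inEigenbasis hH A i j) := by
  have : star (inEigenbasis hH A) = inEigenbasis hH A := by
    rw [← map_star, Matrix.star_eq_conjTranspose, hA]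
  conv_lhs => rw [← this]
  rfl

/-- The two copies are expanded with the weight on opposite indices; the symmetric sum of weights is
what Cauchy–Schwarz calls for. -/
lemma thermal_sq {H : Matrix n n ℂ} (hH : H.IsHermitian) (β : ℝ) {A : Matrix n n ℂ}
    (hA : A.IsHermitian) :
    2 * thermal H β (A * A) = ((∑ i, ∑ j, (weight hH β i + weight hH β j) *
      ‖inEigenbasis hH A i j‖ ^ 2 : ℝ) : ℂ) := by
  have e : ∀ i j, inEigenbasis hH A i j * inEigenbasis hH A j i =
      ((‖inEigenbasis hH A i j‖ ^ 2 : ℝ) : ℂ) := by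
    intro i j
    rw [inEigenbasis_symm_apply hH hA i j, Complex.star_def, Complex.mul_conj, Complex.normSq_eq_norm_sq]
  have e1 : thermal H β (A * A) = ∑ i, ∑ j, (weight hH β i : ℂ) *
      ((‖inEigenbasis hH A i j‖ ^ 2 : ℝ) : ℂ) := by
    rw [thermal_eq_sum hH]
    simp only [map_mul, Matrix.mul_apply, Finset.sum_mul, e]
    exact Finset.sum_congr rfl fun i _ => Finset.sum_congr rfl fun j _ => by ring
  have e2 : thermal H β (A * A) = ∑ i, ∑ j, (weight hH β j : ℂ) *
      ((‖inEigenbasis hH A i j‖ ^ 2 : ℝ) : ℂ) := by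
    rw [e1, Finset.sum_comm]
    refine Finset.sum_congr rfl fun i _ => Finset.sum_congr rfl fun j _ => ?_
    rw [inEigenbasis_symm_apply hH hA i j, norm_star]
  rw [two_mul]
  nth_rewrite 1 [e1]
  rw [e2]
  push_cast
  simp only [← Finset.sum_add_distrib, add_mul]

lemma thermal_double_comm {H : Matrix n n ℂ} (hH : H.IsHermitian) (β : ℝ) {C : Matrix n n ℂ}
    (hC : C.IsHermitian) :
    thermal H β (C * (H * C - C * H) - (H * C - C * H) * C) =
      ((∑ i, ∑ j, ((weight hH β i - weight hH β j) * (hH.eigenvalues j - hH.eigenvalues i)) *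
      ‖inEigenbasis hH C i j‖ ^ 2 : ℝ) : ℂ) := by
  rw [thermal_comm hH]
  push_cast
  refine Finset.sum_congr rfl fun i _ => Finset.sum_congr rfl fun j _ => ?_
  rw [map_sub, map_mul, map_mul, inEigenbasis_self, Matrix.sub_apply, Matrix.diagonal_mul,
    Matrix.mul_diagonal, inEigenbasis_symm_apply hH hC i j]
  have := Complex.mul_conj (inEigenbasis hH C i j)
  rw [Complex.normSq_eq_norm_sq] at this
  push_cast at this
  rw [← this, Complex.star_def]
  ring

/-- The Bogoliubov inequality (with a non-optimal constant). -/
theorem bogoliubov {H C A : Matrix n n ℂ} (hH : H.IsHermitian) (hC : C.IsHermitian)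
    (hA : A.IsHermitian) {β : ℝ} (hβ : 0 ≤ β) :
    ‖thermal H β (C * A - A * C)‖ ^ 2 ≤ 2 * β * (thermal H β (A * A)).re *
      (thermal H β (C * (H * C - C * H) - (H * C - C * H) * C)).re := by
  set w := weight hH β
  set E := hH.eigenvalues
  set a := inEigenbasis hH A with ha
  set c := inEigenbasis hH C with hc
  have h1 : 2 * (thermal H β (A * A)).re = ∑ i, ∑ j, (w i + w j) * ‖a i j‖ ^ 2 := by
    have := congrArg Complex.re (thermal_sq hH β hA)
    rw [Complex.ofReal_re] at this
    rw [← this]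
    simp
  have h2 : (thermal H β (C * (H * C - C * H) - (H * C - C * H) * C)).re =
      ∑ i, ∑ j, ((w i - w j) * (E j - E i)) * ‖c i j‖ ^ 2 := by
    rw [thermal_double_comm hH β hC, Complex.ofReal_re]
  rw [show 2 * β * (thermal H β (A * A)).re = β * (2 * (thermal H β (A * A)).re) by ring, h1, h2,
    thermal_comm hH]
  have hsum : ∀ f : n → n → ℝ, ∑ i, ∑ j, f i j = ∑ p : n × n, f p.1 p.2 := fun f =>
    (Fintype.sum_prod_type' f).symm
  have hw : ∀ i, 0 ≤ w i := weight_nonneg hH β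
  have hwE : ∀ i j, 0 ≤ (w i - w j) * (E j - E i) := by
    intro i j
    rcases le_total (E i) (E j) with h | h
    · refine mul_nonneg (sub_nonneg.2 ?_) (sub_nonneg.2 h)
      refine div_le_div_of_nonneg_right (Real.exp_le_exp.2 ?_)
        (Finset.sum_nonneg fun k _ => (Real.exp_pos _).le)
      exact mul_le_mul_of_nonpos_left h (neg_nonpos.2 hβ)
    · refine mul_nonneg_of_nonpos_of_nonpos (sub_nonpos.2 ?_) (sub_nonpos.2 h)
      refine div_le_div_of_nonneg_right (Real.exp_le_exp.2 ?_)
        (Finset.sum_nonneg fun k _ => (Real.exp_pos _).le)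
      exact mul_le_mul_of_nonpos_left h (neg_nonpos.2 hβ)
  -- Each weight difference is split by `sq_weight_sub_le` into a factor belonging to the double
  -- commutator and one belonging to `A * A`; Cauchy–Schwarz over pairs `(i, j)` then finishes.
  have hstep : ‖∑ i, ∑ j, ((w i - w j : ℝ) : ℂ) * (c i j * a j i)‖ ≤
      ∑ p : n × n, (Real.sqrt ((w p.1 - w p.2) * (E p.2 - E p.1)) * ‖c p.1 p.2‖) *
        (Real.sqrt (β * (w p.1 + w p.2)) * ‖a p.1 p.2‖) := by
    rw [← hsum fun i j => (Real.sqrt ((w i - w j) * (E j - E i)) * ‖c i j‖) *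
        (Real.sqrt (β * (w i + w j)) * ‖a i j‖)]
    refine (norm_sum_le _ _).trans (Finset.sum_le_sum fun i _ => (norm_sum_le _ _).trans
      (Finset.sum_le_sum fun j _ => ?_))
    rw [norm_mul, norm_mul, ha, inEigenbasis_symm_apply hH hA i j, norm_star, Complex.norm_real,
      Real.norm_eq_abs]
    have : |w i - w j| ≤ Real.sqrt ((w i - w j) * (E j - E i)) * Real.sqrt (β * (w i + w j)) := by
      rw [← Real.sqrt_mul (hwE i j)]
      exact Real.abs_le_sqrt (sq_weight_sub_le hH hβ i j)
    calc _ ≤ (Real.sqrt ((w i - w j) * (E j - E i)) * Real.sqrt (β * (w i + w j))) *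
          (‖c i j‖ * ‖a i j‖) := mul_le_mul_of_nonneg_right this (by positivity)
      _ = _ := by ring
  refine (pow_le_pow_left₀ (norm_nonneg _) hstep 2).trans
    ((Finset.sum_mul_sq_le_sq_mul_sq _ _ _).trans (le_of_eq ?_))
  rw [hsum fun i j => (w i + w j) * ‖a i j‖ ^ 2,
    hsum fun i j => ((w i - w j) * (E j - E i)) * ‖c i j‖ ^ 2, mul_comm, Finset.mul_sum _ _ β]
  refine congrArg₂ (fun a b : ℝ => a * b) ?_ ?_
  · refine Finset.sum_congr rfl fun p _ => ?_
    rw [mul_pow, Real.sq_sqrt (mul_nonneg hβ (add_nonneg (hw _) (hw _)))]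
    ring
  · refine Finset.sum_congr rfl fun p _ => ?_
    rw [mul_pow, Real.sq_sqrt (hwE _ _)]

open scoped Matrix.Norms.L2Operator in
-- A weighted average of diagonal entries, each at most the operator norm, which passing to the
-- eigenbasis does not increase.
lemma norm_thermal_le {H : Matrix n n ℂ} (hH : H.IsHermitian) (β : ℝ) (X : Matrix n n ℂ) :
    ‖thermal H β X‖ ≤ ‖X‖ := by
  have hentry : ∀ (Y : Matrix n n ℂ) i, ‖Y i i‖ ≤ ‖Y‖ := by
    intro Y i
    have h := Matrix.l2_opNorm_mulVec Y (EuclideanSpace.single i (1 : ℂ))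
    rw [PiLp.norm_single, norm_one, mul_one] at h
    refine le_trans ?_ h
    refine le_trans (le_of_eq ?_) (PiLp.norm_apply_le _ i)
    simp [Matrix.mulVec_single]
  rw [thermal_eq_sum hH]
  calc _ ≤ ∑ i, ‖X‖ * weight hH β i := by
        refine (norm_sum_le _ _).trans (Finset.sum_le_sum fun i _ => ?_)
        rw [norm_mul, Complex.norm_real, Real.norm_of_nonneg (weight_nonneg hH β i)]
        exact mul_le_mul_of_nonneg_right ((hentry _ i).trans
          (NonUnitalStarAlgHom.norm_apply_le (inEigenbasis hH) X)) (weight_nonneg hH β i)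
    _ ≤ ‖X‖ := by
        rw [← Finset.mul_sum]
        exact mul_le_of_le_one_right (norm_nonneg _) (sum_weight_le_one hH β)

lemma thermal_smul (H : Matrix n n ℂ) (β : ℝ) (c : ℂ) (X : Matrix n n ℂ) :
    thermal H β (c • X) = c * thermal H β X := by
  simp only [thermal, Matrix.smul_mul, Matrix.trace_smul, smul_eq_mul, mul_div_assoc]

/-- Permuting the basis is a continuous algebra automorphism, so it fixes `exp` of whatever multiple
of `H` it fixes. Both the translations and the spin flip permute the product basis, so no other
unitaries are needed. -/
lemma thermal_submatrix (e : n ≃ n) (H : Matrix n n ℂ) (β : ℝ) (X : Matrix n n ℂ)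
    (hH : H.submatrix e e = H) : thermal H β (X.submatrix e e) = thermal H β X := by
  have hexp : (NormedSpace.exp (-(β : ℂ) • H)).submatrix e e = NormedSpace.exp (-(β : ℂ) • H) := by
    have hpow : ∀ (Y : Matrix n n ℂ) (k : ℕ), (Y ^ k).submatrix e e = Y.submatrix e e ^ k :=
      fun Y k => map_pow (Matrix.reindexAlgEquiv ℂ ℂ e.symm) Y k
    have hts : ∀ f : ℕ → Matrix n n ℂ,
        (∑' k, f k).submatrix e e = ∑' k, (f k).submatrix e e := fun f =>
      Function.LeftInverse.map_tsum f (g := (Matrix.reindexAlgEquiv ℂ ℂ e.symm : Matrix n n ℂ ≃ₐ[ℂ] _))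
        (continuous_id.matrix_submatrix e e) (continuous_id.matrix_submatrix e.symm e.symm)
        (fun Y => by ext i j; simp)
    rw [NormedSpace.exp_eq_tsum_rat]
    simp only [hts, Matrix.submatrix_smul, Pi.smul_apply, hpow, hH]
  have htr : ∀ Y : Matrix n n ℂ, (Y.submatrix e e).trace = Y.trace := fun Y =>
    Equiv.sum_comp e fun i => Y i i
  rw [thermal, thermal]
  congr 1
  conv_lhs => rw [← hexp]
  rw [Matrix.submatrix_mul_equiv, htr]

end Bogoliubov

/-! ### Commutation relations -/

lemma conjTranspose_spinRaise_apply (a b : Fin (N + 1)) :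
    (spinRaise N).conjTranspose a b = spinRaise N b a := by
  rw [Matrix.conjTranspose_apply, spinRaise, Matrix.of_apply]
  split_ifs <;> simp

lemma spin_two_mul_spinRaise :
    spin N 2 * spinRaise N - spinRaise N * spin N 2 = spinRaise N := by
  ext a b
  have e : spin N 2 = Matrix.diagonal fun k : Fin (N + 1) => (N : ℂ) / 2 - ((k : ℕ) : ℂ) := rfl
  rw [e, Matrix.sub_apply, Matrix.diagonal_mul, Matrix.mul_diagonal]
  by_cases h : (a : ℕ) + 1 = b
  · have : ((b : ℕ) : ℂ) = (a : ℕ) + 1 := by rw [← h]; push_cast; rfl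
    rw [this]; ring
  · simp [spinRaise, h]

/-- Both products are diagonal, with entries `(a+1)(N-a)` and `a(N-a+1)`, whose difference is `N -
2a`. -/
lemma spinRaise_mul_conjTranspose :
    spinRaise N * (spinRaise N).conjTranspose - (spinRaise N).conjTranspose * spinRaise N =
      (2 : ℂ) • spin N 2 := by
  have sq : ∀ a : Fin (N + 1), (((Real.sqrt (((a : ℝ) + 1) * ((N : ℝ) - (a : ℝ))) : ℝ) : ℂ)) *
      ((Real.sqrt (((a : ℝ) + 1) * ((N : ℝ) - (a : ℝ))) : ℝ) : ℂ) = ((a : ℕ) + 1) * ((N : ℂ) - (a : ℕ)) := by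
    intro a
    have ha : ((a : ℕ) : ℝ) ≤ N := by exact_mod_cast Nat.lt_succ_iff.1 a.2
    rw [← Complex.ofReal_mul, Real.mul_self_sqrt (mul_nonneg (by positivity) (sub_nonneg.2 ha))]
    push_cast; rfl
  have h1 : spinRaise N * (spinRaise N).conjTranspose =
      Matrix.diagonal fun a : Fin (N + 1) => ((a : ℕ) + 1 : ℂ) * ((N : ℂ) - (a : ℕ)) := by
    ext a c
    rw [Matrix.mul_apply]
    simp only [conjTranspose_spinRaise_apply]
    rcases eq_or_ne a c with rfl | hac
    · rw [Matrix.diagonal_apply_eq]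
      by_cases ha : (a : ℕ) + 1 < N + 1
      · rw [Finset.sum_eq_single (⟨a + 1, ha⟩ : Fin (N + 1))]
        · simp [spinRaise, sq]
        · intro b _ hb
          have : ¬ (a : ℕ) + 1 = b := fun h => hb (Fin.ext h.symm)
          simp [spinRaise, this]
        · simp
      · have : (a : ℕ) = N := by have := a.2; omega
        rw [Finset.sum_eq_zero]
        · simp [this]
        · intro b _
          have : ¬ (a : ℕ) + 1 = b := by have := b.2; omega
          simp [spinRaise, this]
    · rw [Matrix.diagonal_apply_ne _ hac]
      refine Finset.sum_eq_zero fun b _ => ?_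
      by_cases h : (a : ℕ) + 1 = b
      · have : ¬ (c : ℕ) + 1 = b := fun h' => hac (Fin.ext (by omega))
        simp [spinRaise, this]
      · simp [spinRaise, h]
  have h2 : (spinRaise N).conjTranspose * spinRaise N =
      Matrix.diagonal fun a : Fin (N + 1) => ((a : ℕ) : ℂ) * ((N : ℂ) - (a : ℕ) + 1) := by
    ext a c
    rw [Matrix.mul_apply]
    simp only [conjTranspose_spinRaise_apply]
    rcases eq_or_ne a c with rfl | hac
    · rw [Matrix.diagonal_apply_eq]
      rcases Nat.eq_zero_or_pos (a : ℕ) with ha | ha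
      · rw [Finset.sum_eq_zero]
        · simp [ha]
        · intro b _
          have : ¬ (b : ℕ) + 1 = a := by omega
          simp [spinRaise, this]
      · have ha' : (a : ℕ) - 1 < N + 1 := by have := a.2; omega
        rw [Finset.sum_eq_single (⟨a - 1, ha'⟩ : Fin (N + 1))]
        · have := sq ⟨a - 1, ha'⟩
          simp only [spinRaise, Matrix.of_apply]
          rw [if_pos (by omega), this]
          simp only [Nat.cast_sub ha]
          push_cast; ring
        · intro b _ hb
          have : ¬ (b : ℕ) + 1 = a := fun h => hb (Fin.ext (by simp; omega))
          simp [spinRaise, this]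
        · simp
    · rw [Matrix.diagonal_apply_ne _ hac]
      refine Finset.sum_eq_zero fun b _ => ?_
      by_cases h : (b : ℕ) + 1 = a
      · have : ¬ (b : ℕ) + 1 = c := fun h' => hac (Fin.ext (by omega))
        simp [spinRaise, this]
      · simp [spinRaise, h]
  rw [h1, h2, spin, ← Matrix.diagonal_sub]
  ext a c
  rcases eq_or_ne a c with rfl | hac
  · simp; ring
  · simp [hac]

lemma isHermitian_spin (j : Fin 3) : (spin N j).IsHermitian := by
  fin_cases j
  · change ((1 / 2 : ℂ) • (spinRaise N + (spinRaise N).conjTranspose)).conjTranspose = _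
    rw [Matrix.conjTranspose_smul, Matrix.conjTranspose_add, Matrix.conjTranspose_conjTranspose,
      add_comm (spinRaise N).conjTranspose]
    simp [spin]
  · change ((1 / (2 * Complex.I) : ℂ) • (spinRaise N - (spinRaise N).conjTranspose)).conjTranspose = _
    rw [Matrix.conjTranspose_smul, Matrix.conjTranspose_sub, Matrix.conjTranspose_conjTranspose,
      ← neg_sub, smul_neg, ← neg_smul]
    simp [spin]
  · change (Matrix.diagonal _).conjTranspose = Matrix.diagonal _
    rw [Matrix.diagonal_conjTranspose]
    congr 1
    funext k
    simp

lemma spin_comm_zero_one :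
    spin N 0 * spin N 1 - spin N 1 * spin N 0 = Complex.I • spin N 2 := by
  have h := spinRaise_mul_conjTranspose (N := N)
  set P := spinRaise N
  set Q := P.conjTranspose
  have : spin N 2 = (1 / 2 : ℂ) • (P * Q - Q * P) := by rw [h, smul_smul]; norm_num
  rw [this]
  change ((1 / 2 : ℂ) • (P + Q)) * ((1 / (2 * Complex.I) : ℂ) • (P - Q)) -
    ((1 / (2 * Complex.I) : ℂ) • (P - Q)) * ((1 / 2 : ℂ) • (P + Q)) = _
  have hi : (1 / (2 * Complex.I) : ℂ) = -(Complex.I / 2) := by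
    field_simp; rw [Complex.I_sq, neg_neg]
  rw [hi]
  simp only [Matrix.smul_mul, Matrix.mul_smul, mul_add, mul_sub, add_mul, sub_mul]
  module

lemma spin_comm_two (j : Fin 3) (hj : j = 0 ∨ j = 1) :
    spin N 2 * spin N j - spin N j * spin N 2 =
      (if j = 0 then Complex.I else -Complex.I) • spin N (if j = 0 then 1 else 0) := by
  have h := spin_two_mul_spinRaise (N := N)
  have h' : spin N 2 * (spinRaise N).conjTranspose - (spinRaise N).conjTranspose * spin N 2 =
      -(spinRaise N).conjTranspose := by
    have := congrArg Matrix.conjTranspose h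
    rw [Matrix.conjTranspose_sub, Matrix.conjTranspose_mul, Matrix.conjTranspose_mul,
      isHermitian_spin 2] at this
    rw [← neg_sub, this]
  have hi : (1 / (2 * Complex.I) : ℂ) = -(Complex.I / 2) := by
    field_simp; rw [Complex.I_sq, neg_neg]
  have hI : Complex.I * Complex.I = -1 := Complex.I_mul_I
  set P := spinRaise N with hP
  set Q := P.conjTranspose with hQ
  have e0 : spin N 0 = (1 / 2 : ℂ) • (P + Q) := rfl
  have e1 : spin N 1 = -(Complex.I / 2) • (P - Q) := by rw [← hi]; rfl
  rcases hj with rfl | rfl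
  · rw [if_pos rfl, if_pos rfl, e0, e1]
    calc _ = (1 / 2 : ℂ) • ((spin N 2 * P - P * spin N 2) + (spin N 2 * Q - Q * spin N 2)) := by
          simp only [Matrix.smul_mul, Matrix.mul_smul, mul_add, add_mul]; module
      _ = (1 / 2 : ℂ) • (P - Q) := by rw [h, h', sub_eq_add_neg]
      _ = _ := by
          rw [smul_smul]; congr 1
          linear_combination (1 / 2 : ℂ) * hI
  · rw [if_neg (by decide), if_neg (by decide), e0, e1]
    calc _ = -(Complex.I / 2) • ((spin N 2 * P - P * spin N 2) - (spin N 2 * Q - Q * spin N 2)) := by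
          simp only [Matrix.smul_mul, Matrix.mul_smul, mul_sub, sub_mul]; module
      _ = -(Complex.I / 2) • (P + Q) := by rw [h, h', sub_neg_eq_add]
      _ = _ := by rw [smul_smul]; congr 1; ring

/-! ### Spin operators as total functions of the site -/

/-- `oneSite` as a homomorphism. -/
def oneSiteHom (x : Site d) : Matrix (Fin (N + 1)) (Fin (N + 1)) ℂ →⋆ₐ[ℂ] Obs d N {x} where
  __ := (Matrix.reindexAlgEquiv ℂ ℂ
    (Equiv.funUnique ↥({x} : Finset (Site d)) (Fin (N + 1))).symm).toAlgHom
  map_star' _ := rfl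

/-- The embedding of the matrices at the site `x` into `𝔄_Γ`. -/
def siteHom {Γ : Finset (Site d)} (x : ↥Γ) :
    Matrix (Fin (N + 1)) (Fin (N + 1)) ℂ →⋆ₐ[ℂ] Obs d N Γ :=
  (embed (Finset.singleton_subset_iff.2 x.2)).comp (oneSiteHom x.1)

lemma spinAt_eq_siteHom {Γ : Finset (Site d)} (x : ↥Γ) (j : Fin 3) :
    spinAt x j = siteHom x (spin N j) := rfl

lemma siteHom_apply {Γ : Finset (Site d)} (x : ↥Γ) (M : Matrix (Fin (N + 1)) (Fin (N + 1)) ℂ)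
    (σ τ : Config d N Γ) :
    siteHom x M σ τ = M (σ x) (τ x) * if ∀ y, y ≠ x → σ y = τ y then 1 else 0 := by
  change embed (Finset.singleton_subset_iff.2 x.2) (oneSite x.1 M) σ τ = _
  rw [embed_apply]
  congr 1
  refine if_congr (forall_congr' fun y => ?_) rfl rfl
  rw [Finset.mem_singleton, Ne, Subtype.ext_iff]

lemma siteHom_mul_apply {Γ : Finset (Site d)} {x y : ↥Γ} (hxy : x ≠ y)
    (M M' : Matrix (Fin (N + 1)) (Fin (N + 1)) ℂ) (σ τ : Config d N Γ) :
    (siteHom x M * siteHom y M') σ τ = M (σ x) (τ x) * M' (σ y) (τ y) *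
      if ∀ z, z ≠ x → z ≠ y → σ z = τ z then 1 else 0 := by
  -- The only intermediate configuration that contributes has already changed at `x` and not yet at
  -- `y`.
  rw [Matrix.mul_apply, Finset.sum_eq_single (Function.update σ x (τ x))]
  · simp only [siteHom_apply, Function.update_self]
    rw [if_pos (fun z hz => by rw [Function.update_of_ne hz]), mul_one,
      Function.update_of_ne hxy.symm, mul_assoc]
    congr 2
    refine if_congr (forall_congr' fun z => ?_) rfl rfl
    by_cases hz : z = x
    · subst hz; simp
    · simp [hz]
  · intro υ _ hυ
    rw [siteHom_apply, siteHom_apply]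
    by_cases h1 : ∀ z, z ≠ x → σ z = υ z
    · by_cases h2 : ∀ z, z ≠ y → υ z = τ z
      · refine absurd (funext fun z => ?_) hυ
        by_cases hz : z = x
        · subst hz; rw [Function.update_self, h2 _ hxy]
        · rw [Function.update_of_ne hz, h1 z hz]
      · rw [if_neg h2]; ring
    · rw [if_neg h1]; ring
  · simp

lemma siteHom_commute {Γ : Finset (Site d)} {x y : ↥Γ} (hxy : x ≠ y)
    (M M' : Matrix (Fin (N + 1)) (Fin (N + 1)) ℂ) :
    Commute (siteHom x M) (siteHom y M') := by
  ext σ τ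
  rw [siteHom_mul_apply hxy, siteHom_mul_apply hxy.symm, mul_comm (M _ _)]
  congr 1
  exact if_congr (forall_congr' fun z => forall_comm) rfl rfl

lemma embed_spinAt {Γ₁ Γ₂ : Finset (Site d)} (h : Γ₁ ≤ Γ₂) (x : ↥Γ₁) (j : Fin 3) :
    embed h (spinAt (N := N) x j) = spinAt ⟨x.1, h x.2⟩ j :=
  (instDirectedSystemObs (d := d) (N := N)).map_map _ h _

/-- The spin operator at `x` in `𝔄_Γ`, with the value `0` for `x ∉ Γ`. -/
def siteSpin (Γ : Finset (Site d)) (j : Fin 3) (x : Site d) : Obs d N Γ :=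
  if h : x ∈ Γ then spinAt ⟨x, h⟩ j else 0

lemma siteSpin_of_mem {Γ : Finset (Site d)} {x : Site d} (h : x ∈ Γ) (j : Fin 3) :
    siteSpin (N := N) Γ j x = spinAt ⟨x, h⟩ j := dif_pos h

lemma siteSpin_coe {Γ : Finset (Site d)} (x : ↥Γ) (j : Fin 3) :
    siteSpin (N := N) Γ j x.1 = spinAt x j := dif_pos x.2

lemma embed_siteSpin {Γ₁ Γ₂ : Finset (Site d)} (h : Γ₁ ≤ Γ₂) {x : Site d} (hx : x ∈ Γ₁) (j : Fin 3) :
    embed h (siteSpin (N := N) Γ₁ j x) = siteSpin Γ₂ j x := by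
  rw [siteSpin_of_mem hx, siteSpin_of_mem (h hx), embed_spinAt]

lemma siteSpin_commute (Γ : Finset (Site d)) {x y : Site d} (hxy : x ≠ y) (j k : Fin 3) :
    Commute (siteSpin (N := N) Γ j x) (siteSpin Γ k y) := by
  unfold siteSpin
  split_ifs with hx hy
  · exact siteHom_commute (fun h => hxy (congrArg Subtype.val h)) _ _
  · exact Commute.zero_right _
  · exact Commute.zero_left _
  · exact Commute.zero_left _

lemma isHermitian_siteSpin (Γ : Finset (Site d)) (j : Fin 3) (x : Site d) :
    (siteSpin (N := N) Γ j x).IsHermitian := by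
  unfold siteSpin
  split_ifs with hx
  · rw [spinAt_eq_siteHom, Matrix.IsHermitian, ← Matrix.star_eq_conjTranspose, ← map_star,
      Matrix.star_eq_conjTranspose, isHermitian_spin]
  · exact Matrix.isHermitian_zero

lemma siteSpin_comm_zero_one (Γ : Finset (Site d)) (x : Site d) :
    siteSpin (N := N) Γ 0 x * siteSpin Γ 1 x - siteSpin Γ 1 x * siteSpin Γ 0 x =
      Complex.I • siteSpin Γ 2 x := by
  unfold siteSpin
  split_ifs with hx
  · simp only [spinAt_eq_siteHom, ← map_mul, ← map_sub, spin_comm_zero_one, map_smul]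
  · simp

lemma siteSpin_comm_two_zero (Γ : Finset (Site d)) (x : Site d) :
    siteSpin (N := N) Γ 2 x * siteSpin Γ 0 x - siteSpin Γ 0 x * siteSpin Γ 2 x =
      Complex.I • siteSpin Γ 1 x := by
  unfold siteSpin
  split_ifs with hx
  · simp only [spinAt_eq_siteHom, ← map_mul, ← map_sub, spin_comm_two 0 (Or.inl rfl), map_smul,
      if_true]
  · simp

open scoped Matrix.Norms.L2Operator in
-- Star homomorphisms are contractive, so the one-site norms bound everything; uniformity in `Γ` is
-- what lets the estimates survive the infinite-volume limit.
lemma exists_norm_siteSpin_le (N : ℕ) : ∃ κ : ℝ, 0 ≤ κ ∧ ∀ (d : ℕ) (Γ : Finset (Site d))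
    (j : Fin 3) (x : Site d), ‖siteSpin (N := N) Γ j x‖ ≤ κ := by
  refine ⟨∑ j, ‖spin N j‖, Finset.sum_nonneg fun j _ => norm_nonneg _, fun d Γ j x => ?_⟩
  have h0 : ‖spin N j‖ ≤ ∑ j, ‖spin N j‖ :=
    Finset.single_le_sum (f := fun j => ‖spin N j‖) (fun j _ => norm_nonneg _) (Finset.mem_univ j)
  unfold siteSpin
  split_ifs with hx
  · exact (NonUnitalStarAlgHom.norm_apply_le (siteHom (N := N) (⟨x, hx⟩ : ↥Γ)) (spin N j)).trans h0
  · rw [norm_zero]; exact (norm_nonneg _).trans h0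

/-! ### Double commutators -/

section Algebra

variable {ι R : Type*} [Ring R] [Algebra ℂ R]

/-- `Z ↦ C Z - Z C`. -/
def comm (C : R) : R →ₗ[ℂ] R := LinearMap.mulLeft ℂ C - LinearMap.mulRight ℂ C

lemma comm_apply (C Z : R) : comm C Z = C * Z - Z * C := rfl

lemma double_comm_eq (C Z : R) :
    C * (Z * C - C * Z) - (Z * C - C * Z) * C = -comm C (comm C Z) := by
  rw [comm_apply, comm_apply]; noncomm_ring

lemma comm_sum (s : Finset ι) (T : ι → R) (g : ι → ℂ) (Z : R) :
    comm (∑ z ∈ s, g z • T z) Z = ∑ z ∈ s, g z • comm (T z) Z := by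
  simp only [comm_apply, Finset.sum_mul, Finset.mul_sum, smul_mul_assoc, mul_smul_comm, smul_sub,
    Finset.sum_sub_distrib]

lemma comm_eq_zero {C Z : R} (h : Commute C Z) : comm C Z = 0 := by
  rw [comm_apply, h.eq, sub_self]

lemma comm_sum_of_one {s : Finset ι} {T : ι → R} {g : ι → ℂ} {Z : R} {x : ι} (hx : x ∈ s)
    (hZ : ∀ z, z ≠ x → Commute (T z) Z) :
    comm (∑ z ∈ s, g z • T z) Z = g x • comm (T x) Z := by
  rw [comm_sum]
  refine Finset.sum_eq_single_of_mem x hx fun z _ hz => ?_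
  rw [comm_eq_zero (hZ z hz), smul_zero]

/-- Invariance of `Z` under `T x + T y` makes the two surviving commutators opposite. This turns the
field `g` into its gradient. -/
lemma comm_sum_of_two {s : Finset ι} {T : ι → R} {g : ι → ℂ} {Z : R} {x y : ι} (hx : x ∈ s)
    (hy : y ∈ s) (hxy : x ≠ y) (hZ : ∀ z, z ≠ x → z ≠ y → Commute (T z) Z)
    (h : Commute (T x + T y) Z) :
    comm (∑ z ∈ s, g z • T z) Z = (g x - g y) • comm (T x) Z := by
  have hy' : comm (T y) Z = -comm (T x) Z := by
    have := h.eq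
    rw [add_mul, mul_add] at this
    rw [comm_apply, comm_apply, neg_sub, sub_eq_sub_iff_add_eq_add, add_comm, this, add_comm]
  classical
  rw [comm_sum, Finset.sum_eq_add_of_mem x y hx hy hxy, hy']
  · module
  · intro z _ hz
    rw [comm_eq_zero (hZ z hz.1 hz.2), smul_zero]

/-- `𝐒_x · 𝐒_y`. -/
def exchange (S : Fin 3 → ι → R) (x y : ι) : R := ∑ j, S j x * S j y

/-- `[S_x^{(1)}, [S_x^{(1)}, 𝐒_x · 𝐒_y]]`. -/
def twist (S : Fin 3 → ι → R) (x y : ι) : R := comm (S 0 x) (comm (S 0 x) (exchange S x y))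

lemma mul_comm_add {a a' b b' : R} (h : Commute a b') (h' : Commute a' b) :
    comm (a + a') (b * b') = comm a b * b' + b * comm a' b' := by
  simp only [comm_apply, add_mul, mul_add, sub_mul, mul_sub]
  have e1 : b * b' * a = b * a * b' := by rw [mul_assoc, ← h.eq, mul_assoc]
  have e2 : a' * (b * b') = b * (a' * b') := by rw [← mul_assoc, h'.eq, mul_assoc]
  rw [e1, e2, ← mul_assoc a b b', ← mul_assoc b b' a']
  abel

/-- Invariance of `𝐒_x · 𝐒_y` under a joint rotation about the first axis: the contributions of the
second and third components cancel. -/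
lemma commute_exchange {S : Fin 3 → ι → R}
    (hcomm : ∀ x y, x ≠ y → ∀ j k, Commute (S j x) (S k y))
    (h01 : ∀ x, comm (S 0 x) (S 1 x) = Complex.I • S 2 x)
    (h20 : ∀ x, comm (S 2 x) (S 0 x) = Complex.I • S 1 x)
    {x y : ι} (hxy : x ≠ y) : Commute (S 0 x + S 0 y) (exchange S x y) := by
  have h02 : ∀ x, comm (S 0 x) (S 2 x) = -(Complex.I • S 1 x) := by
    intro x
    rw [← h20, comm_apply, comm_apply, neg_sub]
  have h00 : ∀ x, comm (S 0 x) (S 0 x) = 0 := fun x => sub_self _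
  have : comm (S 0 x + S 0 y) (exchange S x y) = 0 := by
    rw [exchange, map_sum, Fin.sum_univ_three]
    simp only [mul_comm_add (hcomm x y hxy _ _) (hcomm y x hxy.symm _ _), h00, h01, h02]
    simp only [smul_mul_assoc, mul_smul_comm, neg_mul, mul_neg, zero_mul, mul_zero]
    abel
  exact sub_eq_zero.1 this

lemma comm_comm_exchange {S : Fin 3 → ι → R}
    (hcomm : ∀ x y, x ≠ y → ∀ j k, Commute (S j x) (S k y))
    (h01 : ∀ x, comm (S 0 x) (S 1 x) = Complex.I • S 2 x)
    (h20 : ∀ x, comm (S 2 x) (S 0 x) = Complex.I • S 1 x)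
    {s : Finset ι} {g : ι → ℂ} {x y : ι} (hx : x ∈ s) (hy : y ∈ s)
    (hxy : x ≠ y) :
    comm (∑ z ∈ s, g z • S 0 z) (comm (∑ z ∈ s, g z • S 0 z) (exchange S x y)) =
      (g x - g y) ^ 2 • twist S x y := by
  have hz : ∀ z, z ≠ x → z ≠ y → Commute (S 0 z) (exchange S x y) := fun z hzx hzy =>
    Commute.sum_right _ _ _ fun j _ => (hcomm z x hzx _ _).mul_right (hcomm z y hzy _ _)
  have hE := commute_exchange hcomm h01 h20 hxy
  rw [comm_sum_of_two hx hy hxy hz hE, map_smul, comm_sum_of_two hx hy hxy, smul_smul, sq, twist]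
  -- The inner commutator is again supported on `x` and `y` and invariant under `S 0 x + S 0 y`, so
  -- the same reduction yields a second factor `g x - g y`.
  · intro z hzx hzy
    have h0 := hcomm z x hzx 0 0
    exact (h0.mul_right (hz z hzx hzy)).sub_right ((hz z hzx hzy).mul_right h0)
  · have h0 : Commute (S 0 x + S 0 y) (S 0 x) :=
      (Commute.refl _).add_left (hcomm y x hxy.symm 0 0)
    exact (h0.mul_right hE).sub_right (hE.mul_right h0)

/-- Two rotations bring the third component back to itself. This term involves `g` and not its
gradient; it is harmless only because it carries the factor `B`. -/
lemma comm_comm_two {S : Fin 3 → ι → R}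
    (hcomm : ∀ x y, x ≠ y → ∀ j k, Commute (S j x) (S k y))
    (h01 : ∀ x, comm (S 0 x) (S 1 x) = Complex.I • S 2 x)
    (h20 : ∀ x, comm (S 2 x) (S 0 x) = Complex.I • S 1 x)
    {s : Finset ι} {g : ι → ℂ} {x : ι} (hx : x ∈ s) :
    comm (∑ z ∈ s, g z • S 0 z) (comm (∑ z ∈ s, g z • S 0 z) (S 2 x)) = g x ^ 2 • S 2 x := by
  have h02 : comm (S 0 x) (S 2 x) = -(Complex.I • S 1 x) := by
    rw [← h20, comm_apply, comm_apply, neg_sub]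
  rw [comm_sum_of_one hx fun z hz => hcomm z x hz 0 2, h02, map_smul, map_neg, map_smul,
    comm_sum_of_one hx fun z hz => hcomm z x hz 0 1, h01, smul_smul, smul_neg, smul_smul, ← neg_smul, smul_smul]
  congr 1
  linear_combination (-(g x) ^ 2) * Complex.I_mul_I

end Algebra

/-! ### Norm bounds for commutators. -/

section Norm

variable {ι R : Type*} [NormedRing R] [NormedAlgebra ℂ R]

lemma norm_comm_le (C Z : R) : ‖comm C Z‖ ≤ 2 * ‖C‖ * ‖Z‖ := by
  rw [comm_apply]
  have h1 := norm_mul_le C Z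
  have h2 := norm_mul_le Z C
  have h3 := norm_sub_le (C * Z) (Z * C)
  linarith [mul_comm ‖C‖ ‖Z‖]

lemma norm_twist_le {S : Fin 3 → ι → R} {κ : ℝ} (hκ : 0 ≤ κ) (hS : ∀ j x, ‖S j x‖ ≤ κ) (x y : ι) :
    ‖twist S x y‖ ≤ 12 * κ ^ 4 := by
  have h1 : ‖exchange S x y‖ ≤ 3 * κ ^ 2 := by
    refine (norm_sum_le_of_le _ fun j _ => (norm_mul_le _ _).trans
      (mul_le_mul (hS j x) (hS j y) (norm_nonneg _) hκ)).trans (le_of_eq ?_)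
    simp; ring
  have h2 : ‖comm (S 0 x) (exchange S x y)‖ ≤ 2 * κ * (3 * κ ^ 2) :=
    (norm_comm_le _ _).trans (by gcongr; exact hS 0 x)
  calc _ ≤ 2 * κ * (2 * κ * (3 * κ ^ 2)) := (norm_comm_le _ _).trans (by gcongr; exact hS 0 x)
    _ = _ := by ring

end Norm

/-! ### The Hamiltonian -/

lemma PeriodicNeighbor.ne {L : ℕ} {x y : Site d} (h : PeriodicNeighbor L x y) : x ≠ y := by
  rintro rfl
  obtain ⟨i, -, h | h⟩ := h
  · have : (2 : ℤ) ∣ x i - x i - 1 := (Dvd.intro _ rfl).trans h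
    omega
  · have : (2 : ℤ) ∣ x i - x i + 1 := (Dvd.intro _ rfl).trans h
    omega

lemma orderParameter_eq (L : ℕ) : orderParameter d N L =
    ∑ x ∈ box d L, stagger x • siteSpin (box d L) 2 x := by
  rw [orderParameter, ← Finset.sum_coe_sort (box d L)]
  simp only [siteSpin_coe]

open Classical in
lemma hamiltonianZero_eq (L : ℕ) : hamiltonianZero d N L =
    (1 / 2 : ℂ) • ∑ x ∈ box d L, ∑ y ∈ box d L,
      if PeriodicNeighbor L x y then exchange (siteSpin (box d L)) x y else 0 := by
  rw [hamiltonianZero, ← Finset.sum_coe_sort (box d L)]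
  congr 1
  refine Finset.sum_congr rfl fun x _ => ?_
  rw [← Finset.sum_coe_sort (box d L)]
  simp only [siteSpin_coe, exchange]

lemma isHermitian_hamiltonian (L : ℕ) (B : ℝ) : (hamiltonian d N L B).IsHermitian := by
  classical
  have hS := isHermitian_siteSpin (d := d) (N := N) (box d L)
  rw [hamiltonian, hamiltonianZero_eq, orderParameter_eq]
  refine Matrix.IsHermitian.sub ?_ ?_
  · rw [Matrix.IsHermitian, Matrix.conjTranspose_smul, Matrix.conjTranspose_sum]
    simp only [Matrix.conjTranspose_sum]
    congr 1
    · simp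
    · refine Finset.sum_congr rfl fun x _ => Finset.sum_congr rfl fun y _ => ?_
      split_ifs with h
      · rw [exchange, Matrix.conjTranspose_sum]
        refine Finset.sum_congr rfl fun j _ => ?_
        rw [Matrix.conjTranspose_mul, hS, hS, (siteSpin_commute _ h.ne j j).eq]
      · exact Matrix.conjTranspose_zero
  · rw [Matrix.IsHermitian, Matrix.conjTranspose_smul, Matrix.conjTranspose_sum]
    congr 1
    · simp
    · refine Finset.sum_congr rfl fun x _ => ?_
      rw [Matrix.conjTranspose_smul, hS, stagger]
      congr 1
      simp [star_zpow₀]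

/-- The field `∑_x g(x) S_x^{(1)}` generating a local rotation. -/
def rotationField (L : ℕ) (g : Site d → ℝ) : Obs d N (box d L) :=
  ∑ x ∈ box d L, (g x : ℂ) • siteSpin (box d L) 0 x

lemma isHermitian_sum_smul_siteSpin (s Γ : Finset (Site d)) (j : Fin 3) (f : Site d → ℂ)
    (hf : ∀ x, star (f x) = f x) :
    (∑ x ∈ s, f x • siteSpin (N := N) Γ j x).IsHermitian := by
  rw [Matrix.IsHermitian, Matrix.conjTranspose_sum]
  refine Finset.sum_congr rfl fun x _ => ?_
  rw [Matrix.conjTranspose_smul, isHermitian_siteSpin, hf]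

lemma star_stagger (x : Site d) : star (stagger x) = stagger x := by
  simp [stagger, star_zpow₀]

lemma norm_stagger (x : Site d) : ‖stagger x‖ = 1 := by
  simp [stagger]

open Classical in
lemma double_comm_hamiltonian (L : ℕ) (B : ℝ) (g : Site d → ℝ) :
    let C : Obs d N (box d L) := rotationField L g
    let H := hamiltonian d N L B
    C * (H * C - C * H) - (H * C - C * H) * C =
      -((1 / 2 : ℂ) • ∑ x ∈ box d L, ∑ y ∈ box d L, (if PeriodicNeighbor L x y then
        ((g x : ℂ) - (g y : ℂ)) ^ 2 • twist (siteSpin (box d L)) x y else 0)) +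
      (B : ℂ) • ∑ x ∈ box d L, (stagger x * (g x : ℂ) ^ 2) • siteSpin (box d L) 2 x := by
  intro C H
  have hc := fun x y (h : x ≠ y) j k => siteSpin_commute (d := d) (N := N) (box d L) h j k
  have h01 := siteSpin_comm_zero_one (N := N) (box d L)
  have h20 := siteSpin_comm_two_zero (N := N) (box d L)
  rw [double_comm_eq]
  simp only [C, H, hamiltonian, hamiltonianZero_eq, orderParameter_eq, map_sub, map_smul, map_sum,
    rotationField]
  rw [neg_sub, sub_eq_add_neg, add_comm]
  congr 1
  · congr 2
    refine Finset.sum_congr rfl fun x hx => Finset.sum_congr rfl fun y hy => ?_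
    split_ifs with h
    · exact comm_comm_exchange hc h01 h20 hx hy h.ne
    · rw [map_zero, map_zero]
  · congr 1
    refine Finset.sum_congr rfl fun x hx => ?_
    rw [comm_comm_two hc h01 h20 hx, smul_smul]

open scoped Matrix.Norms.L2Operator in
open Classical in
-- Bounding the operator itself rather than its expectation keeps the estimate independent of the
-- temperature and the state.
lemma norm_double_comm_hamiltonian_le {κ : ℝ} (hκ : 0 ≤ κ) (L : ℕ)
    (hS : ∀ j x, ‖siteSpin (N := N) (box d L) j x‖ ≤ κ) (B : ℝ) (g : Site d → ℝ) :
    let C : Obs d N (box d L) := rotationField L g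
    let H := hamiltonian d N L B
    ‖C * (H * C - C * H) - (H * C - C * H) * C‖ ≤
      6 * κ ^ 4 * (∑ x ∈ box d L, ∑ y ∈ box d L, if PeriodicNeighbor L x y then
        (g x - g y) ^ 2 else 0) + |B| * (κ * ∑ x ∈ box d L, g x ^ 2) := by
  intro C H
  rw [double_comm_hamiltonian]
  refine (norm_add_le _ _).trans (add_le_add ?_ ?_)
  · rw [norm_neg, norm_smul, show (6 * κ ^ 4 : ℝ) = 1 / 2 * (12 * κ ^ 4) by ring, mul_assoc]
    refine mul_le_mul (by norm_num) ?_ (norm_nonneg _) (by norm_num)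
    rw [Finset.mul_sum]
    refine norm_sum_le_of_le _ fun x _ => ?_
    rw [Finset.mul_sum]
    refine norm_sum_le_of_le _ fun y _ => ?_
    split_ifs with h
    · rw [norm_smul, mul_comm]
      refine mul_le_mul (norm_twist_le hκ hS x y) (le_of_eq ?_) (norm_nonneg _) (by positivity)
      rw [norm_pow, ← Complex.ofReal_sub, Complex.norm_real, Real.norm_eq_abs, sq_abs]
    · rw [norm_zero, mul_zero]
  · rw [norm_smul, Complex.norm_real, Real.norm_eq_abs, Finset.mul_sum]
    refine mul_le_mul_of_nonneg_left (norm_sum_le_of_le _ fun x _ => ?_) (abs_nonneg _)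
    rw [norm_smul, norm_mul, norm_stagger, one_mul, norm_pow, Complex.norm_real, Real.norm_eq_abs,
      sq_abs, mul_comm]
    exact mul_le_mul_of_nonneg_right (hS 2 x) (sq_nonneg _)

/-! ### Translation symmetry -/

lemma mem_box {L : ℕ} {x : Site d} : x ∈ box d L ↔ ∀ i, -(L : ℤ) + 1 ≤ x i ∧ x i ≤ L := by
  simp [box]

/-- Each side of the box has exactly `2 L` points, one per residue class. -/
lemma eq_of_dvd_of_mem_box {L : ℕ} {x y : Site d} (hx : x ∈ box d L) (hy : y ∈ box d L) (i : Fin d)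
    (h : 2 * (L : ℤ) ∣ x i - y i) : x i = y i := by
  have h1 := mem_box.1 hx i
  have h2 := mem_box.1 hy i
  refine sub_eq_zero.1 (Int.eq_zero_of_abs_lt_dvd h ?_)
  rw [abs_lt]
  constructor <;> linarith

/-- The representative of `t` modulo `2 L` in `{-L+1, …, L}`. -/
def wrap (L : ℕ) (t : ℤ) : ℤ := (t + L - 1) % (2 * L) - L + 1

lemma dvd_wrap_sub (L : ℕ) (t : ℤ) : 2 * (L : ℤ) ∣ wrap L t - t := by
  refine ⟨-((t + L - 1) / (2 * L)), ?_⟩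
  have := Int.emod_add_mul_ediv (t + L - 1) (2 * L)
  rw [wrap]
  linarith

lemma wrap_mem_box {L : ℕ} (hL : 1 ≤ L) (x : Site d) : (fun i => wrap L (x i)) ∈ box d L := by
  refine mem_box.2 fun i => ?_
  have h1 := Int.emod_nonneg (x i + L - 1) (b := 2 * (L : ℤ)) (by omega)
  have h2 := Int.emod_lt_of_pos (x i + L - 1) (b := 2 * (L : ℤ)) (by omega)
  rw [wrap]
  omega

/-- The periodic translation of the box by `v`. -/
def boxShift {L : ℕ} (hL : 1 ≤ L) (v : Site d) : Equiv.Perm ↥(box d L) where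
  toFun x := ⟨fun i => wrap L ((x.1 + v) i), wrap_mem_box hL _⟩
  invFun x := ⟨fun i => wrap L ((x.1 - v) i), wrap_mem_box hL _⟩
  left_inv x := by
    refine Subtype.ext (funext fun i => eq_of_dvd_of_mem_box (wrap_mem_box hL _) x.2 i ?_)
    have h1 := dvd_wrap_sub L ((x.1 + v) i)
    have h2 := dvd_wrap_sub L (wrap L ((x.1 + v) i) - v i)
    have := dvd_add h1 h2
    rw [Pi.add_apply] at this
    convert! this using 1
    simp only [Pi.sub_apply, Pi.add_apply]
    ring
  right_inv x := by
    refine Subtype.ext (funext fun i => eq_of_dvd_of_mem_box (wrap_mem_box hL _) x.2 i ?_)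
    have h1 := dvd_wrap_sub L ((x.1 - v) i)
    have h2 := dvd_wrap_sub L (wrap L ((x.1 - v) i) + v i)
    have := dvd_add h1 h2
    rw [Pi.sub_apply] at this
    convert! this using 1
    simp only [Pi.sub_apply, Pi.add_apply]
    ring

lemma dvd_boxShift {L : ℕ} (hL : 1 ≤ L) (v : Site d) (x : ↥(box d L)) (i : Fin d) :
    2 * (L : ℤ) ∣ (boxShift hL v x).1 i - (x.1 i + v i) := dvd_wrap_sub L _

lemma boxShift_of_mem {L : ℕ} (hL : 1 ≤ L) (v : Site d) (x : ↥(box d L)) (h : x.1 + v ∈ box d L) :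
    (boxShift hL v x).1 = x.1 + v :=
  funext fun i => eq_of_dvd_of_mem_box (boxShift hL v x).2 h i (dvd_boxShift hL v x i)

lemma PeriodicNeighbor.of_dvd {L : ℕ} {x y x' y' v : Site d} (h : PeriodicNeighbor L x y)
    (hx' : x' ∈ box d L) (hy' : y' ∈ box d L) (hx : ∀ i, 2 * (L : ℤ) ∣ x' i - (x i + v i))
    (hy : ∀ i, 2 * (L : ℤ) ∣ y' i - (y i + v i)) : PeriodicNeighbor L x' y' := by
  obtain ⟨i, hk, hi⟩ := h
  refine ⟨i, fun k hki => eq_of_dvd_of_mem_box hx' hy' k ?_, ?_⟩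
  · have := dvd_sub (hx k) (hy k)
    rw [hk k hki] at this
    simpa using this
  · have := dvd_sub (hx i) (hy i)
    rw [show x' i - (x i + v i) - (y' i - (y i + v i)) = (x' i - y' i) - (x i - y i) by ring] at this
    refine hi.imp (fun h => ?_) fun h => ?_
    · convert! dvd_add this h using 1; ring
    · convert! dvd_add this h using 1; ring

lemma periodicNeighbor_boxShift {L : ℕ} (hL : 1 ≤ L) (v : Site d) (x y : ↥(box d L)) :
    PeriodicNeighbor L (boxShift hL v x).1 (boxShift hL v y).1 ↔ PeriodicNeighbor L x.1 y.1 := by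
  constructor
  · refine fun h => h.of_dvd (v := -v) x.2 y.2 (fun i => ?_) fun i => ?_
    · rw [← dvd_neg]
      convert! dvd_boxShift hL v x i using 1; rw [Pi.neg_apply]; ring
    · rw [← dvd_neg]
      convert! dvd_boxShift hL v y i using 1; rw [Pi.neg_apply]; ring
  · exact fun h => h.of_dvd (boxShift hL v x).2 (boxShift hL v y).2 (dvd_boxShift hL v x)
      (dvd_boxShift hL v y)

/-! ### Sublattice parity and the spin flip. -/

lemma stagger_add (x y : Site d) : stagger (x + y) = stagger x * stagger y := by
  simp only [stagger, Pi.add_apply, Finset.sum_add_distrib]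
  exact zpow_add₀ (by norm_num) _ _

lemma stagger_mul_self (x : Site d) : stagger x * stagger x = 1 := by
  rw [stagger, ← mul_zpow]
  simp

lemma stagger_congr {x y : Site d} (h : ∀ i, (2 : ℤ) ∣ x i - y i) : stagger x = stagger y := by
  have h2 : (2 : ℤ) ∣ ∑ i, x i - ∑ i, y i := by
    rw [← Finset.sum_sub_distrib]
    exact Finset.dvd_sum fun i _ => h i
  obtain ⟨k, hk⟩ := h2
  rw [stagger, stagger, show ∑ i, x i = ∑ i, y i + 2 * k by linarith, zpow_add₀ (by norm_num), zpow_mul]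
  norm_num

/-- The period `2 L` is even, so wrapping around the box preserves the sublattice parity. -/
lemma stagger_boxShift {L : ℕ} (hL : 1 ≤ L) (v : Site d) (x : ↥(box d L)) :
    stagger (boxShift hL v x).1 = stagger x.1 * stagger v := by
  rw [← stagger_add]
  exact stagger_congr fun i => (Dvd.intro _ rfl).trans (dvd_boxShift hL v x i)

open Classical in
/-- The reversal of the eigenvalues of `S⁽³⁾` if `v` is an odd site, the identity otherwise. -/
def spinFlip (N : ℕ) (v : Site d) : Equiv.Perm (Fin (N + 1)) :=
  if stagger v = 1 then Equiv.refl _ else Fin.revPerm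

lemma stagger_eq_one_or (v : Site d) : stagger v = 1 ∨ stagger v = -1 :=
  mul_self_eq_one_iff.1 (stagger_mul_self v)

/-- The factor `(a+1)(N-a)` is symmetric under reversal, which therefore swaps raising and lowering.
Reversal thus acts as the rotation by `π` about the first axis. -/
lemma spinRaise_submatrix_rev :
    (spinRaise N).submatrix Fin.rev Fin.rev = (spinRaise N).conjTranspose := by
  ext a b
  rw [conjTranspose_spinRaise_apply, Matrix.submatrix_apply]
  simp only [spinRaise, Matrix.of_apply]
  have ha := a.2
  have hb := b.2
  have ea : ((Fin.rev a : Fin (N + 1)) : ℕ) = N - a := by rw [Fin.val_rev]; omega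
  have eb : ((Fin.rev b : Fin (N + 1)) : ℕ) = N - b := by rw [Fin.val_rev]; omega
  rw [ea, eb]
  by_cases h : (b : ℕ) + 1 = a
  · rw [if_pos h, if_pos (by omega)]
    have : ((a : ℕ) : ℝ) = b + 1 := by rw [← h]; push_cast; rfl
    rw [Nat.cast_sub (by omega), this]
    congr 2
    ring
  · rw [if_neg h, if_neg (by omega)]

/-- The sign of `S^{(j)}` under the translation by `v` combined with the rotation by `π` about the
first axis for odd `v`. -/
def flipSign (v : Site d) (j : Fin 3) : ℂ := if j = 0 then 1 else stagger v

lemma flipSign_mul_self (v : Site d) (j : Fin 3) : flipSign v j * flipSign v j = 1 := by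
  rw [flipSign]
  split_ifs
  · exact one_mul 1
  · exact stagger_mul_self v

lemma spin_submatrix_spinFlip (v : Site d) (j : Fin 3) :
    (spin N j).submatrix (spinFlip N v) (spinFlip N v) = flipSign v j • spin N j := by
  rcases stagger_eq_one_or v with h | h
  · simp [spinFlip, flipSign, h]
  · have hf : spinFlip N v = Fin.revPerm := by rw [spinFlip, if_neg (by rw [h]; norm_num)]
    have hr' : (spinRaise N).conjTranspose.submatrix Fin.rev Fin.rev = spinRaise N := by
      rw [← Matrix.conjTranspose_submatrix, spinRaise_submatrix_rev, Matrix.conjTranspose_conjTranspose]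
    have hr := spinRaise_submatrix_rev (N := N)
    rw [hf, flipSign, h]
    fin_cases j
    · change ((1 / 2 : ℂ) • ((spinRaise N).submatrix Fin.rev Fin.rev +
        (spinRaise N).conjTranspose.submatrix Fin.rev Fin.rev)) = _
      rw [hr, hr', add_comm (spinRaise N).conjTranspose]
      simp [spin]
    · change ((1 / (2 * Complex.I) : ℂ) • ((spinRaise N).submatrix Fin.rev Fin.rev -
        (spinRaise N).conjTranspose.submatrix Fin.rev Fin.rev)) = _
      rw [hr, hr', ← neg_sub, smul_neg]
      change _ = (-1 : ℂ) • ((1 / (2 * Complex.I) : ℂ) • (spinRaise N - (spinRaise N).conjTranspose))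
      rw [neg_one_smul]
    · ext a b
      have e : spin N 2 = Matrix.diagonal fun k : Fin (N + 1) => (N : ℂ) / 2 - ((k : ℕ) : ℂ) := rfl
      change (spin N 2) a.rev b.rev = _
      rw [if_neg (by simp)]
      change _ = ((-1 : ℂ) • spin N 2) a b
      rw [e, Matrix.smul_apply]
      rcases eq_or_ne a b with rfl | hab
      · rw [Matrix.diagonal_apply_eq, Matrix.diagonal_apply_eq, Fin.val_rev, Nat.cast_sub (by omega)]
        push_cast
        simp; ring
      · rw [Matrix.diagonal_apply_ne _ hab, Matrix.diagonal_apply_ne _ (by simpa using hab), smul_zero]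

/-- The action of the translation by `v` (and of the spin flip for odd `v`) on configurations. -/
def configShift {L : ℕ} (hL : 1 ≤ L) (N : ℕ) (v : Site d) : Equiv.Perm (Config d N (box d L)) :=
  Equiv.arrowCongr (boxShift hL v).symm (spinFlip N v)

/-- The automorphism of `𝔄_Λ` given by the translation by `v` (and the spin flip for odd `v`). -/
def obsShift {L : ℕ} (hL : 1 ≤ L) (N : ℕ) (v : Site d) : Obs d N (box d L) ≃ₐ[ℂ] Obs d N (box d L) :=
  Matrix.reindexAlgEquiv ℂ ℂ (configShift hL N v).symm

lemma obsShift_apply {L : ℕ} (hL : 1 ≤ L) (v : Site d) (A : Obs d N (box d L)) :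
    obsShift hL N v A = A.submatrix (configShift hL N v) (configShift hL N v) := rfl

lemma obsShift_spinAt {L : ℕ} (hL : 1 ≤ L) (v : Site d) (x : ↥(box d L)) (j : Fin 3) :
    obsShift hL N v (spinAt x j) = flipSign v j • spinAt (boxShift hL v x) j := by
  rw [spinAt_eq_siteHom, spinAt_eq_siteHom, ← map_smul, ← spin_submatrix_spinFlip]
  ext σ τ
  rw [obsShift_apply, Matrix.submatrix_apply, siteHom_apply, siteHom_apply]
  change spin N j (spinFlip N v (σ (boxShift hL v x))) (spinFlip N v (τ (boxShift hL v x))) * _ = _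
  rw [Matrix.submatrix_apply]
  congr 1
  refine if_congr ?_ rfl rfl
  rw [← (boxShift hL v).forall_congr_right (q := fun y => y ≠ boxShift hL v x → σ y = τ y)]
  refine forall_congr' fun y => ?_
  rw [Ne, Ne, EmbeddingLike.apply_eq_iff_eq]
  exact imp_congr_right fun _ => (spinFlip N v).injective.eq_iff

/-- In the exchange term every flip sign occurs squared. In the field term the flip of `S⁽³⁾`
compensates the change of the staggering under an odd translation. -/
lemma obsShift_hamiltonian {L : ℕ} (hL : 1 ≤ L) (v : Site d) (B : ℝ) :
    obsShift hL N v (hamiltonian d N L B) = hamiltonian d N L B := by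
  classical
  set e := boxShift hL v with he
  rw [hamiltonian, map_sub, map_smul]
  congr 1
  · rw [hamiltonianZero, map_smul, map_sum]
    congr 1
    refine Eq.trans ?_ (Equiv.sum_comp e _)
    refine Finset.sum_congr rfl fun x _ => ?_
    rw [map_sum]
    refine Eq.trans ?_ (Equiv.sum_comp e _)
    refine Finset.sum_congr rfl fun y _ => ?_
    simp only [he, periodicNeighbor_boxShift]
    split_ifs
    · rw [map_sum]
      refine Finset.sum_congr rfl fun j _ => ?_
      rw [map_mul, obsShift_spinAt, obsShift_spinAt, smul_mul_smul_comm, flipSign_mul_self, one_smul]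
    · exact map_zero _
  · congr 1
    rw [orderParameter, map_sum]
    refine Eq.trans ?_ (Equiv.sum_comp e _)
    refine Finset.sum_congr rfl fun x _ => ?_
    rw [map_smul, obsShift_spinAt, smul_smul, he, stagger_boxShift]
    rfl

lemma gibbs_obsShift {L : ℕ} (hL : 1 ≤ L) (v : Site d) (β B : ℝ) (A : Obs d N (box d L)) :
    gibbs L β B (obsShift hL N v A) = gibbs L β B A :=
  thermal_submatrix (configShift hL N v) _ β A (obsShift_hamiltonian hL v B)

lemma gibbs_smul (L : ℕ) (β B : ℝ) (c : ℂ) (A : Obs d N (box d L)) :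
    gibbs L β B (c • A) = c * gibbs L β B A := thermal_smul _ _ _ _

lemma obsShift_siteSpin {L : ℕ} (hL : 1 ≤ L) {v x : Site d} (hx : x ∈ box d L)
    (hxv : x + v ∈ box d L) (j : Fin 3) :
    obsShift hL N v (siteSpin (box d L) j x) = flipSign v j • siteSpin (box d L) j (x + v) := by
  rw [siteSpin_of_mem hx, siteSpin_of_mem hxv, obsShift_spinAt]
  congr 2
  exact Subtype.ext (boxShift_of_mem hL v _ hxv)

lemma gibbs_siteSpin_two {L : ℕ} (hL : 1 ≤ L) {x : Site d} (hx : x ∈ box d L) (β B : ℝ) :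
    gibbs L β B (siteSpin (N := N) (box d L) 2 0) =
      stagger x * gibbs L β B (siteSpin (N := N) (box d L) 2 x) := by
  have h0 : (0 : Site d) ∈ box d L := mem_box.2 fun i => by simp; omega
  rw [← gibbs_obsShift hL x, obsShift_siteSpin hL h0 (by rwa [zero_add]), zero_add, gibbs_smul]
  rfl

/-- The two flip signs cancel, so this correlation is invariant under odd translations too, despite
the staggered field. -/
lemma gibbs_siteSpin_one_mul {L : ℕ} (hL : 1 ≤ L) {x y v : Site d} (hx : x ∈ box d L)
    (hy : y ∈ box d L) (hxv : x + v ∈ box d L) (hyv : y + v ∈ box d L) (β B : ℝ) :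
    gibbs L β B (siteSpin (N := N) (box d L) 1 x * siteSpin (box d L) 1 y) =
      gibbs L β B (siteSpin (N := N) (box d L) 1 (x + v) * siteSpin (box d L) 1 (y + v)) := by
  rw [← gibbs_obsShift hL v, map_mul, obsShift_siteSpin hL hx hxv, obsShift_siteSpin hL hy hyv,
    smul_mul_smul_comm, flipSign_mul_self, one_smul]

/-! ### Lattice sums -/

lemma card_box (d L : ℕ) : (box d L).card = (2 * L) ^ d := by
  rw [box, Fintype.card_piFinset_const, Int.card_Icc]
  congr 1
  omega

lemma box_mono {L L' : ℕ} (h : L ≤ L') : box d L ≤ box d L' := fun x hx =>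
  mem_box.2 fun i => by have := mem_box.1 hx i; omega

/-- The tent function with the value `1` on `Λ_R` and support in `Λ_{2R}`. -/
def cutoff (R : ℕ) (x : Site d) : ℝ := max 0 (min 1 (2 - ‖x‖ / R))

lemma cutoff_nonneg (R : ℕ) (x : Site d) : 0 ≤ cutoff R x := le_max_left _ _

lemma cutoff_le_one (R : ℕ) (x : Site d) : cutoff R x ≤ 1 := max_le zero_le_one (min_le_left _ _)

lemma cutoff_of_mem_box {R : ℕ} (hR : 1 ≤ R) {x : Site d} (hx : x ∈ box d R) : cutoff R x = 1 := by
  have hR' : (0 : ℝ) < R := by exact_mod_cast hR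
  have : ‖x‖ ≤ R := by
    refine (pi_norm_le_iff_of_nonneg hR'.le).2 fun i => ?_
    have := mem_box.1 hx i
    rw [Int.norm_eq_abs, abs_le]
    constructor
    · have h : (-(R : ℤ)) ≤ x i := by linarith
      exact_mod_cast h
    · exact_mod_cast this.2
  have h1 : ‖x‖ / R ≤ 1 := (div_le_one hR').2 this
  rw [cutoff, min_eq_left (by linarith), max_eq_right zero_le_one]

lemma norm_lt_of_cutoff_ne_zero {R : ℕ} (hR : 1 ≤ R) {x : Site d} (hx : cutoff R x ≠ 0) :
    ‖x‖ < 2 * R := by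
  have hR' : (0 : ℝ) < R := by exact_mod_cast hR
  by_contra! h
  refine hx (max_eq_left ((min_le_right _ _).trans ?_))
  have : 2 ≤ ‖x‖ / R := (le_div_iff₀ hR').2 h
  linarith

lemma abs_lt_of_norm_lt {n : ℕ} {x : Site d} (hx : ‖x‖ < n) (i : Fin d) : |x i| < n := by
  have := (norm_le_pi_norm x i).trans_lt hx
  rw [Int.norm_eq_abs] at this
  exact_mod_cast this

lemma mem_box_of_norm_lt {L : ℕ} {x : Site d} (hx : ‖x‖ < L) : x ∈ box d L := by
  refine mem_box.2 fun i => ?_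
  have := abs_lt.1 (abs_lt_of_norm_lt hx i)
  omega

lemma abs_cutoff_sub_le {R : ℕ} (x y : Site d) : |cutoff R x - cutoff R y| ≤ ‖x - y‖ / R := by
  have h1 := abs_max_sub_max_le_abs (min 1 (2 - ‖x‖ / R)) (min 1 (2 - ‖y‖ / R)) (0 : ℝ)
  have h2 := abs_min_sub_min_le_max (1 : ℝ) (2 - ‖x‖ / R) 1 (2 - ‖y‖ / R)
  rw [sub_self, abs_zero, max_eq_right (abs_nonneg _)] at h2
  rw [cutoff, cutoff, max_comm 0, max_comm 0]
  refine (h1.trans h2).trans ?_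
  rw [show (2 - ‖x‖ / R) - (2 - ‖y‖ / R) = -((‖x‖ - ‖y‖) / R) by ring, abs_neg, abs_div, Nat.abs_cast]
  exact div_le_div_of_nonneg_right (abs_norm_sub_norm_le x y) (Nat.cast_nonneg R)

/-- The `2 d` nearest neighbours of a site. -/
def neighbors (x : Site d) : Finset (Site d) :=
  (Finset.univ : Finset (Fin d × Bool)).image fun p =>
    Function.update x p.1 (x p.1 + if p.2 then 1 else -1)

lemma card_neighbors_le (x : Site d) : (neighbors x).card ≤ 2 * d := by
  refine Finset.card_image_le.trans ?_
  rw [Finset.card_univ, Fintype.card_prod, Fintype.card_fin, Fintype.card_bool, mul_comm]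

lemma norm_sub_le_of_mem_neighbors {x y : Site d} (h : y ∈ neighbors x) : ‖x - y‖ ≤ 1 := by
  obtain ⟨⟨i, b⟩, -, rfl⟩ := Finset.mem_image.1 h
  refine (pi_norm_le_iff_of_nonneg zero_le_one).2 fun k => ?_
  rw [Pi.sub_apply]
  rcases eq_or_ne k i with rfl | hk
  · rw [Function.update_self]
    cases b <;> simp
  · rw [Function.update_of_ne hk]; simp

lemma PeriodicNeighbor.symm {L : ℕ} {x y : Site d} (h : PeriodicNeighbor L x y) :
    PeriodicNeighbor L y x := by
  obtain ⟨i, hk, hi⟩ := h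
  refine ⟨i, fun k hki => (hk k hki).symm, hi.symm.imp (fun h => ?_) fun h => ?_⟩
  · rw [← dvd_neg]; convert! h using 1; ring
  · rw [← dvd_neg]; convert! h using 1; ring

/-- The margin excludes bonds that wrap around the box: with `L = 2 R` the one joining `-L+1` to `L`
would still touch the support of the cutoff. -/
lemma PeriodicNeighbor.mem_neighbors {L R : ℕ} (hL : 2 * R + 1 ≤ L) {x y : Site d}
    (h : PeriodicNeighbor L x y) (hx : ‖x‖ < 2 * R) (hy : y ∈ box d L) : y ∈ neighbors x := by
  obtain ⟨i, hk, hi⟩ := h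
  have hxi := abs_lt.1 (abs_lt_of_norm_lt (n := 2 * R) (by push_cast; exact hx) i)
  push_cast at hxi
  have hyi := mem_box.1 hy i
  rw [neighbors, Finset.mem_image]
  rcases hi with hi | hi
  · have : x i - y i - 1 = 0 := Int.eq_zero_of_abs_lt_dvd hi (by rw [abs_lt]; constructor <;> omega)
    refine ⟨(i, false), Finset.mem_univ _, funext fun k => ?_⟩
    rcases eq_or_ne k i with rfl | hki
    · rw [Function.update_self]; simp; omega
    · rw [Function.update_of_ne hki, hk k hki]
  · have : x i - y i + 1 = 0 := Int.eq_zero_of_abs_lt_dvd hi (by rw [abs_lt]; constructor <;> omega)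
    refine ⟨(i, true), Finset.mem_univ _, funext fun k => ?_⟩
    rcases eq_or_ne k i with rfl | hki
    · rw [Function.update_self]; simp; omega
    · rw [Function.update_of_ne hki, hk k hki]

lemma sum_sum_indicator_le {ι : Type*} [DecidableEq ι] (s Q : Finset ι) (n : ι → Finset ι) (k : ℕ)
    (hn : ∀ x, (n x).card ≤ k) :
    ∑ x ∈ s, ∑ y ∈ s, (if x ∈ Q ∧ y ∈ n x then (1 : ℝ) else 0) ≤ Q.card * k := by
  have h1 : ∀ x, ∑ y ∈ s, (if x ∈ Q ∧ y ∈ n x then (1 : ℝ) else 0) ≤ if x ∈ Q then (k : ℝ) else 0 := by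
    intro x
    by_cases hx : x ∈ Q
    · simp only [hx, true_and, if_true]
      rw [Finset.sum_boole]
      refine Nat.cast_le.2 ((Finset.card_le_card fun y hy => ?_).trans (hn x))
      exact (Finset.mem_filter.1 hy).2
    · simp [hx]
  refine (Finset.sum_le_sum fun x _ => h1 x).trans ?_
  rw [← Finset.sum_filter, Finset.sum_const, nsmul_eq_mul]
  refine mul_le_mul_of_nonneg_right (Nat.cast_le.2 (Finset.card_le_card fun y hy => ?_))
    (Nat.cast_nonneg k)
  exact (Finset.mem_filter.1 hy).2

open Classical in
-- The cutoff has slope `1 / R`, and a contributing ordered pair has an endpoint among `(4R)^d`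
-- sites, each with at most `2 d` neighbours; the total has order `R^{d-2}`.
lemma sum_sq_cutoff_sub_le {L R : ℕ} (hR : 1 ≤ R) (hL : 2 * R + 1 ≤ L) :
    (∑ x ∈ box d L, ∑ y ∈ box d L, if PeriodicNeighbor L x y then
      (cutoff R x - cutoff R y) ^ 2 else 0) ≤ 4 * d * (4 * R : ℝ) ^ d / R ^ 2 := by
  have hR' : (0 : ℝ) < R := by exact_mod_cast hR
  set Q := box d (2 * R)
  have hQ : (Q.card : ℝ) = (4 * R : ℝ) ^ d := by
    rw [card_box]; push_cast; ring
  have hmem : ∀ x : Site d, ‖x‖ < 2 * R → x ∈ Q := fun x hx =>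
    mem_box_of_norm_lt (by push_cast; exact hx)
  have hterm : ∀ x ∈ box d L, ∀ y ∈ box d L, (if PeriodicNeighbor L x y then
      (cutoff R x - cutoff R y) ^ 2 else 0) ≤ (1 / R ^ 2 : ℝ) *
        ((if x ∈ Q ∧ y ∈ neighbors x then (1 : ℝ) else 0) +
          (if y ∈ Q ∧ x ∈ neighbors y then (1 : ℝ) else 0)) := by
    intro x hx y hy
    have hnn : ∀ (p : Prop) [Decidable p], (0 : ℝ) ≤ if p then 1 else 0 := fun p _ => by split_ifs <;> norm_num
    have hR2 : (0 : ℝ) ≤ 1 / R ^ 2 := by positivity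
    by_cases h : PeriodicNeighbor L x y
    swap
    · rw [if_neg h]
      exact mul_nonneg hR2 (add_nonneg (hnn _) (hnn _))
    rw [if_pos h]
    have hsq : ‖x - y‖ ≤ 1 → (cutoff R x - cutoff R y) ^ 2 ≤ 1 / R ^ 2 := by
      intro hxy
      rw [← sq_abs, show (1 / R ^ 2 : ℝ) = (1 / R) ^ 2 by rw [div_pow, one_pow]]
      exact pow_le_pow_left₀ (abs_nonneg _) ((abs_cutoff_sub_le x y).trans
        (div_le_div_of_nonneg_right hxy hR'.le)) 2
    by_cases hgx : cutoff R x = 0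
    · by_cases hgy : cutoff R y = 0
      · rw [hgx, hgy, sub_zero, zero_pow two_ne_zero]
        exact mul_nonneg hR2 (add_nonneg (hnn _) (hnn _))
      · have hn := norm_lt_of_cutoff_ne_zero hR hgy
        have hm := h.symm.mem_neighbors hL hn hx
        rw [if_pos (⟨hmem y hn, hm⟩ : y ∈ Q ∧ x ∈ neighbors y)]
        refine (hsq ?_).trans (le_mul_of_one_le_right hR2 (le_add_of_nonneg_left (hnn _)))
        rw [norm_sub_rev]
        exact norm_sub_le_of_mem_neighbors hm
    · have hn := norm_lt_of_cutoff_ne_zero hR hgx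
      have hm := h.mem_neighbors hL hn hy
      rw [if_pos (⟨hmem x hn, hm⟩ : x ∈ Q ∧ y ∈ neighbors x)]
      exact (hsq (norm_sub_le_of_mem_neighbors hm)).trans
        (le_mul_of_one_le_right hR2 (le_add_of_nonneg_right (hnn _)))
  refine (Finset.sum_le_sum fun x hx => Finset.sum_le_sum fun y hy => hterm x hx y hy).trans ?_
  simp only [← Finset.mul_sum, Finset.sum_add_distrib]
  have h1 := sum_sum_indicator_le (box d L) Q neighbors (2 * d) card_neighbors_le
  have h2 : ∑ x ∈ box d L, ∑ y ∈ box d L, (if y ∈ Q ∧ x ∈ neighbors y then (1 : ℝ) else 0) ≤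
      Q.card * (2 * d : ℕ) := by rw [Finset.sum_comm]; exact h1
  calc _ ≤ (1 / R ^ 2 : ℝ) * (Q.card * (2 * d : ℕ) + Q.card * (2 * d : ℕ)) := by gcongr
    _ = _ := by rw [hQ]; push_cast; ring

lemma sum_cutoff_sq_le {L R : ℕ} (hR : 1 ≤ R) :
    ∑ x ∈ box d L, cutoff R x ^ 2 ≤ (4 * R : ℝ) ^ d := by
  have hQ : ((box d (2 * R)).card : ℝ) = (4 * R : ℝ) ^ d := by
    rw [card_box]; push_cast; ring
  have hterm : ∀ x ∈ box d L, cutoff R x ^ 2 ≤ if x ∈ box d (2 * R) then (1 : ℝ) else 0 := by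
    intro x _
    split_ifs with h
    · exact pow_le_one₀ (cutoff_nonneg R x) (cutoff_le_one R x)
    · have : cutoff R x = 0 := by
        by_contra h0
        exact h (mem_box_of_norm_lt (by push_cast; exact norm_lt_of_cutoff_ne_zero hR h0))
      rw [this, zero_pow two_ne_zero]
  refine (Finset.sum_le_sum hterm).trans ?_
  rw [Finset.sum_boole, ← hQ]
  exact Nat.cast_le.2 (Finset.card_le_card fun y hy => (Finset.mem_filter.1 hy).2)

/-! ### Sums of decaying functions over cubes. -/

/-- The cube `{-n, …, n}^d`. -/
def cube (d n : ℕ) : Finset (Site d) := Fintype.piFinset fun _ => Finset.Icc (-(n : ℤ)) n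

lemma mem_cube {n : ℕ} {x : Site d} : x ∈ cube d n ↔ ‖x‖ ≤ n := by
  rw [pi_norm_le_iff_of_nonneg (Nat.cast_nonneg n), cube, Fintype.mem_piFinset]
  refine forall_congr' fun i => ?_
  rw [Finset.mem_Icc, Int.norm_eq_abs, ← abs_le]
  exact_mod_cast Iff.rfl

lemma card_cube (d n : ℕ) : (cube d n).card = (2 * n + 1) ^ d := by
  rw [cube, Fintype.card_piFinset_const, Int.card_Icc]
  congr 1
  omega

lemma pow_sub_pow_le_mul {a b : ℝ} (hb : 0 ≤ b) (hab : b ≤ a) (m : ℕ) :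
    a ^ (m + 1) - b ^ (m + 1) ≤ (m + 1) * (a - b) * a ^ m := by
  induction m with
  | zero => simp
  | succ m ih =>
    have h1 : b ^ (m + 1) * (a - b) ≤ a ^ (m + 1) * (a - b) :=
      mul_le_mul_of_nonneg_right (pow_le_pow_left₀ hb hab _) (sub_nonneg.2 hab)
    have h2 := mul_le_mul_of_nonneg_left ih (hb.trans hab)
    push_cast
    calc _ = a * (a ^ (m + 1) - b ^ (m + 1)) + b ^ (m + 1) * (a - b) := by ring
      _ ≤ a * ((m + 1) * (a - b) * a ^ m) + a ^ (m + 1) * (a - b) := add_le_add h2 h1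
      _ = _ := by ring

/-- With `d = k + 2`, the shell of sup-radius `n + 1` has `O(n^{d-1})` sites of weight
`(n+1)^{-(d-2)}`, hence contributes `O(n)`; induction adds up the shells. -/
lemma sum_cube_inv_norm_pow_le (k : ℕ) (hk : k ≠ 0) (n : ℕ) :
    ∑ w ∈ cube (k + 2) n, (‖w‖ ^ k)⁻¹ ≤ 2 * (k + 2) * 3 ^ (k + 1) * (n : ℝ) ^ 2 := by
  induction n with
  | zero =>
    rw [Finset.sum_eq_zero]
    · simp
    · intro w hw
      have : ‖w‖ = 0 := le_antisymm (by simpa using mem_cube.1 hw) (norm_nonneg _)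
      -- The origin counts zero by the convention `0⁻¹ = 0`; this needs `k ≠ 0`, that is `d ≥ 3`.
      rw [this, zero_pow hk, inv_zero]
  | succ n ih =>
    have hsub : cube (k + 2) n ⊆ cube (k + 2) (n + 1) := fun w hw =>
      mem_cube.2 ((mem_cube.1 hw).trans (by push_cast; linarith))
    rw [← Finset.sum_sdiff hsub]
    have hn : (0 : ℝ) < n + 1 := by positivity
    have hterm : ∀ w ∈ cube (k + 2) (n + 1) \ cube (k + 2) n, (‖w‖ ^ k)⁻¹ ≤ (((n : ℝ) + 1) ^ k)⁻¹ := by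
      intro w hw
      have h2 := (Finset.mem_sdiff.1 hw).2
      have : (n : ℝ) + 1 ≤ ‖w‖ := by
        by_contra! h
        refine h2 (mem_cube.2 ((pi_norm_le_iff_of_nonneg (Nat.cast_nonneg n)).2 fun i => ?_))
        have := abs_lt_of_norm_lt (n := n + 1) (by push_cast; exact h) i
        rw [Int.norm_eq_abs]
        have h' : |w i| ≤ n := by push_cast at this; omega
        exact_mod_cast h'
      gcongr
    have hcard : (((cube (k + 2) (n + 1) \ cube (k + 2) n).card : ℕ) : ℝ) ≤
        2 * (k + 2) * (3 * (n + 1)) ^ (k + 1) := by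
      rw [Finset.card_sdiff_of_subset hsub, Nat.cast_sub (Finset.card_le_card hsub), card_cube, card_cube]
      push_cast
      have := pow_sub_pow_le_mul (a := 2 * (n + 1) + 1) (b := 2 * (n : ℝ) + 1) (by positivity)
        (by linarith) (k + 1)
      push_cast at this
      refine this.trans ?_
      calc _ = 2 * ((k : ℝ) + 2) * (2 * (n + 1) + 1) ^ (k + 1) := by ring
        _ ≤ _ := by gcongr; linarith [(Nat.cast_nonneg n : (0 : ℝ) ≤ n)]
    have hshell : ∑ w ∈ cube (k + 2) (n + 1) \ cube (k + 2) n, (‖w‖ ^ k)⁻¹ ≤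
        2 * (k + 2) * 3 ^ (k + 1) * ((n : ℝ) + 1) := by
      refine (Finset.sum_le_sum hterm).trans ?_
      rw [Finset.sum_const, nsmul_eq_mul]
      calc _ ≤ 2 * ((k : ℝ) + 2) * (3 * (n + 1)) ^ (k + 1) * (((n : ℝ) + 1) ^ k)⁻¹ := by gcongr
        _ = _ := by
          rw [mul_pow, pow_succ ((n : ℝ) + 1)]
          field_simp
    refine (add_le_add hshell ih).trans ?_
    push_cast
    rw [← mul_add]
    refine mul_le_mul_of_nonneg_left ?_ (by positivity)
    nlinarith [(Nat.cast_nonneg n : (0 : ℝ) ≤ n)]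

lemma sum_box_sub_le {R : ℕ} {G : Site d → ℝ} (hG : ∀ w, 0 ≤ G w) :
    ∑ x ∈ box d R, ∑ y ∈ box d R, G (y - x) ≤ (2 * R : ℝ) ^ d * ∑ w ∈ cube d (2 * R), G w := by
  have h : ∀ x ∈ box d R, ∑ y ∈ box d R, G (y - x) ≤ ∑ w ∈ cube d (2 * R), G w := by
    intro x hx
    rw [← Finset.sum_image (g := fun y => y - x) (f := G) fun y _ z _ h => sub_left_injective h]
    refine Finset.sum_le_sum_of_subset_of_nonneg (fun w hw => ?_) fun w _ _ => hG w
    obtain ⟨y, hy, rfl⟩ := Finset.mem_image.1 hw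
    rw [cube, Fintype.mem_piFinset]
    intro i
    have h1 := mem_box.1 hx i
    have h2 := mem_box.1 hy i
    rw [Finset.mem_Icc, Pi.sub_apply]
    push_cast
    omega
  refine (Finset.sum_le_sum h).trans (le_of_eq ?_)
  rw [Finset.sum_const, nsmul_eq_mul, card_box]
  push_cast
  rfl

/-- The near part is a constant independent of `n` and the far part is a small multiple of `n ^ 2`:
this is the form in which `o(n ^ 2)` is used. -/
lemma sum_cube_le_of_decay {k : ℕ} (hk : k ≠ 0) {G : Site (k + 2) → ℝ} (hG : ∀ w, 0 ≤ G w) {ε : ℝ}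
    (hε : 0 ≤ ε) {r : ℕ} (hr : ∀ w, (r : ℝ) < ‖w‖ → G w ≤ ε * (‖w‖ ^ k)⁻¹) (n : ℕ) :
    ∑ w ∈ cube (k + 2) n, G w ≤
      ∑ w ∈ cube (k + 2) r, G w + ε * (2 * (k + 2) * 3 ^ (k + 1) * (n : ℝ) ^ 2) := by
  have hterm : ∀ w ∈ cube (k + 2) n, G w ≤
      (if w ∈ cube (k + 2) r then G w else 0) + ε * (‖w‖ ^ k)⁻¹ := by
    intro w _
    split_ifs with h
    · exact le_add_of_nonneg_right (by positivity)
    · rw [zero_add]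
      exact hr w (not_le.1 fun h' => h (mem_cube.2 h'))
  refine (Finset.sum_le_sum hterm).trans ?_
  rw [Finset.sum_add_distrib, ← Finset.mul_sum]
  refine add_le_add ?_ (mul_le_mul_of_nonneg_left (sum_cube_inv_norm_pow_le k hk n) hε)
  rw [← Finset.sum_filter]
  exact Finset.sum_le_sum_of_subset_of_nonneg (fun w hw => (Finset.mem_filter.1 hw).2)
    fun w _ _ => hG w

lemma norm_sub_le_siteDist (x y : Site d) : ‖x - y‖ ≤ siteDist x y := by
  refine (pi_norm_le_iff_of_nonneg (Real.sqrt_nonneg _)).2 fun i => Real.le_sqrt_of_sq_le ?_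
  rw [Pi.sub_apply, Int.norm_eq_abs, sq_abs]
  push_cast
  exact Finset.single_le_sum (f := fun i => ((x i : ℝ) - (y i : ℝ)) ^ 2) (fun i _ => sq_nonneg _)
    (Finset.mem_univ i)

/-! ### The fluctuation bound -/

lemma thermal_sq_re_nonneg {n : Type*} [Fintype n] [DecidableEq n] {H A : Matrix n n ℂ}
    (hH : H.IsHermitian) (β : ℝ) (hA : A.IsHermitian) : 0 ≤ (thermal H β (A * A)).re := by
  have h := congrArg Complex.re (thermal_sq hH β hA)
  rw [Complex.ofReal_re] at h
  have h2 : (2 * thermal H β (A * A)).re = 2 * (thermal H β (A * A)).re := by simp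
  have : 0 ≤ ∑ i, ∑ j, (weight hH β i + weight hH β j) * ‖inEigenbasis hH A i j‖ ^ 2 :=
    Finset.sum_nonneg fun i _ => Finset.sum_nonneg fun j _ =>
      mul_nonneg (add_nonneg (weight_nonneg hH β i) (weight_nonneg hH β j)) (sq_nonneg _)
  linarith

/-- The transverse staggered magnetization `∑_{x ∈ Λ_R} (-1)^x S_x^{(2)}`. -/
def transverse (d N R : ℕ) : Obs d N (box d R) :=
  ∑ x ∈ box d R, stagger x • siteSpin (box d R) 1 x

lemma embed_sum_siteSpin {Γ₁ Γ₂ : Finset (Site d)} (h : Γ₁ ≤ Γ₂) (f : Site d → ℂ) (j : Fin 3) :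
    embed h (∑ x ∈ Γ₁, f x • siteSpin (N := N) Γ₁ j x) = ∑ x ∈ Γ₁, f x • siteSpin Γ₂ j x := by
  rw [map_sum]
  refine Finset.sum_congr rfl fun x hx => ?_
  rw [map_smul, embed_siteSpin h hx]

/-- `transverse` lives on the box where the cutoff equals 1, so each site is rotated with full
strength and no boundary term appears. -/
lemma comm_rotationField_transverse {L R : ℕ} (hR : 1 ≤ R) (h : box d R ≤ box d L) :
    comm (rotationField L (cutoff R)) (embed h (transverse d N R)) =
      Complex.I • embed h (orderParameter d N R) := by
  rw [transverse, orderParameter_eq, embed_sum_siteSpin, embed_sum_siteSpin, rotationField, map_sum,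
    Finset.smul_sum]
  refine Finset.sum_congr rfl fun x hx => ?_
  rw [map_smul, comm_sum_of_one (h hx) fun z hz => siteSpin_commute _ hz 0 1, comm_apply,
    siteSpin_comm_zero_one, cutoff_of_mem_box hR hx, Complex.ofReal_one, one_smul, smul_comm]

open scoped Matrix.Norms.L2Operator in
lemma norm_gibbs_orderParameter_sq_le {κ : ℝ} (hκ : 0 ≤ κ) {L R : ℕ} (hR : 1 ≤ R)
    (hL : 2 * R + 1 ≤ L) (hS : ∀ j x, ‖siteSpin (N := N) (box d L) j x‖ ≤ κ)
    (h : box d R ≤ box d L) {β : ℝ} (hβ : 0 ≤ β) (B : ℝ) :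
    ‖gibbs L β B (embed h (orderParameter d N R))‖ ^ 2 ≤
      2 * β * (gibbs L β B (embed h (transverse d N R * transverse d N R))).re *
        (6 * κ ^ 4 * (4 * d * (4 * R : ℝ) ^ d / R ^ 2) + |B| * (κ * (4 * R : ℝ) ^ d)) := by
  classical
  set H := hamiltonian d N L B with hHdef
  set C : Obs d N (box d L) := rotationField L (cutoff R) with hCdef
  set A := embed h (transverse d N R) with hAdef
  have hH : H.IsHermitian := isHermitian_hamiltonian L B
  have hC : C.IsHermitian := isHermitian_sum_smul_siteSpin _ _ _ _ fun x => Complex.conj_ofReal _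
  have hA : A.IsHermitian := by
    rw [hAdef, transverse, embed_sum_siteSpin]
    exact isHermitian_sum_smul_siteSpin _ _ _ _ star_stagger
  have hb := bogoliubov hH hC hA hβ
  have hcomm : C * A - A * C = Complex.I • embed h (orderParameter d N R) :=
    comm_rotationField_transverse hR h
  rw [hcomm, thermal_smul, norm_mul, Complex.norm_I, one_mul] at hb
  have hAA : A * A = embed h (transverse d N R * transverse d N R) := (map_mul _ _ _).symm
  have h0 := thermal_sq_re_nonneg hH β hA
  rw [hAA] at hb h0
  refine hb.trans (mul_le_mul_of_nonneg_left ?_ (mul_nonneg (by positivity) h0))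
  refine (Complex.re_le_norm _).trans ((norm_thermal_le hH β _).trans
    ((norm_double_comm_hamiltonian_le hκ L hS B (cutoff R)).trans ?_))
  exact add_le_add (mul_le_mul_of_nonneg_left (sum_sq_cutoff_sub_le hR hL) (by positivity))
    (mul_le_mul_of_nonneg_left (mul_le_mul_of_nonneg_left (sum_cutoff_sq_le hR) hκ) (abs_nonneg B))

/-! ### Equilibrium states -/

lemma spinOp_eq_incl {Γ : Finset (Site d)} {x : Site d} (hx : x ∈ Γ) (j : Fin 3) :
    spinOp N x j = incl Γ (siteSpin Γ j x) := by
  rw [siteSpin_of_mem hx]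
  exact (incl_embed _ _).symm

lemma incl_sum_siteSpin (Γ : Finset (Site d)) (f : Site d → ℂ) (j : Fin 3) :
    incl Γ (∑ x ∈ Γ, f x • siteSpin (N := N) Γ j x) = ∑ x ∈ Γ, f x • spinOp N x j := by
  rw [map_sum]
  refine Finset.sum_congr rfl fun x hx => ?_
  rw [map_smul, spinOp_eq_incl hx]

namespace IsEquilibriumState

variable {β B : ℝ} {ρ : WeakDual ℂ (QuasiLocalAlgebra d N)}

/-- Symmetries of the finite-volume states need only hold in large boxes; in boxes not containing
`Γ` both sides have the default value 0. -/
lemma apply_incl_eq (hρ : IsEquilibriumState β B ρ) {Γ : Finset (Site d)} {A A' : Obs d N Γ}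
    (h : ∀ᶠ l in atTop, ∀ h : Γ ≤ box d l, gibbs l β B (embed h A) = gibbs l β B (embed h A')) :
    ρ (incl Γ A) = ρ (incl Γ A') := by
  obtain ⟨L, hL, hlim⟩ := hρ
  refine tendsto_nhds_unique (hlim Γ A) ((hlim Γ A').congr' ?_)
  filter_upwards [hL.eventually h] with k hk
  by_cases hΓ : Γ ≤ box d (L k)
  · rw [gibbsLocal, gibbsLocal, dif_pos hΓ, dif_pos hΓ, hk hΓ]
  · rw [gibbsLocal, gibbsLocal, dif_neg hΓ, dif_neg hΓ]

lemma spinOp_one_mul_add (hρ : IsEquilibriumState β B ρ) (x y v : Site d) :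
    ρ (spinOp N x 1 * spinOp N y 1) = ρ (spinOp N (x + v) 1 * spinOp N (y + v) 1) := by
  set Γ : Finset (Site d) := {x, y, x + v, y + v} with hΓ
  have hx : x ∈ Γ := by simp [hΓ]
  have hy : y ∈ Γ := by simp [hΓ]
  have hxv : x + v ∈ Γ := by simp [hΓ]
  have hyv : y + v ∈ Γ := by simp [hΓ]
  rw [spinOp_eq_incl hx, spinOp_eq_incl hy, spinOp_eq_incl hxv, spinOp_eq_incl hyv, ← map_mul,
    ← map_mul]
  refine hρ.apply_incl_eq ?_
  filter_upwards [eventually_ge_atTop 1] with l hl h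
  rw [map_mul, map_mul, embed_siteSpin h hx, embed_siteSpin h hy, embed_siteSpin h hxv,
    embed_siteSpin h hyv]
  exact gibbs_siteSpin_one_mul hl (h hx) (h hy) (h hxv) (h hyv) β B

lemma spinOp_two (hρ : IsEquilibriumState β B ρ) (x : Site d) :
    ρ (spinOp N 0 2) = stagger x * ρ (spinOp N x 2) := by
  set Γ : Finset (Site d) := {0, x} with hΓ
  have h0 : (0 : Site d) ∈ Γ := by simp [hΓ]
  have hx : x ∈ Γ := by simp [hΓ]
  rw [← smul_eq_mul, ← map_smul, spinOp_eq_incl hx, spinOp_eq_incl h0, ← map_smul]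
  refine hρ.apply_incl_eq ?_
  filter_upwards [eventually_ge_atTop 1] with l hl h
  rw [map_smul, embed_siteSpin h hx, embed_siteSpin h h0, gibbs_smul]
  exact gibbs_siteSpin_two hl (h hx) β B

lemma orderParameter_apply (hρ : IsEquilibriumState β B ρ) (R : ℕ) :
    ρ (incl (box d R) (orderParameter d N R)) = ((box d R).card : ℂ) * ρ (spinOp N 0 2) := by
  rw [orderParameter_eq, incl_sum_siteSpin, map_sum]
  rw [Finset.sum_congr rfl fun x _ => show ρ (stagger x • spinOp N x 2) = ρ (spinOp N 0 2) by
    rw [map_smul, smul_eq_mul, ← hρ.spinOp_two x]]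
  rw [Finset.sum_const, nsmul_eq_mul]

lemma magnetization_eq (hρ : IsEquilibriumState β B ρ) {ℓ : ℕ} (hℓ : 1 ≤ ℓ) :
    magnetization ℓ ρ = ρ (spinOp N 0 2) := by
  rw [magnetization, hρ.orderParameter_apply, mul_div_cancel_left₀]
  rw [card_box]
  exact_mod_cast pow_ne_zero d (by omega)

/-- The limit `L → ∞` at fixed `R` and `B`: the last factor does not depend on `L`, and the other
quantities are expectations of observables in the fixed box of size `R`. -/
lemma norm_spinOp_two_sq_le (hρ : IsEquilibriumState β B ρ) (hβ : 0 ≤ β) {κ : ℝ} (hκ : 0 ≤ κ)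
    (hS : open scoped Matrix.Norms.L2Operator in
      ∀ (Γ : Finset (Site d)) (j : Fin 3) (x : Site d), ‖siteSpin (N := N) Γ j x‖ ≤ κ)
    {R : ℕ} (hR : 1 ≤ R) :
    ((2 * R : ℝ) ^ d) ^ 2 * ‖ρ (spinOp N 0 2)‖ ^ 2 ≤
      2 * β * (ρ (incl (box d R) (transverse d N R * transverse d N R))).re *
        (6 * κ ^ 4 * (4 * d * (4 * R : ℝ) ^ d / R ^ 2) + |B| * (κ * (4 * R : ℝ) ^ d)) := by
  have hcard : ((2 * R : ℝ) ^ d) ^ 2 * ‖ρ (spinOp N 0 2)‖ ^ 2 =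
      ‖ρ (incl (box d R) (orderParameter d N R))‖ ^ 2 := by
    rw [hρ.orderParameter_apply, norm_mul, card_box, Complex.norm_natCast, ← mul_pow]
    push_cast
    rfl
  rw [hcard]
  obtain ⟨L, hL, hlim⟩ := id hρ
  refine le_of_tendsto_of_tendsto ((hlim _ _).norm.pow 2)
    (((Complex.continuous_re.tendsto _).comp (hlim _ _)).const_mul (2 * β) |>.mul_const _) ?_
  filter_upwards [hL.eventually_ge_atTop (2 * R + 1)] with k hk
  have h : box d R ≤ box d (L k) := box_mono (by omega)
  simp only [Function.comp, gibbsLocal, dif_pos h]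
  exact norm_gibbs_orderParameter_sq_le hκ hR hk (hS _) h hβ B

end IsEquilibriumState

lemma incl_transverse_mul (R : ℕ) : incl (box d R) (transverse d N R * transverse d N R) =
    ∑ x ∈ box d R, ∑ y ∈ box d R, (stagger x * stagger y) • (spinOp N x 1 * spinOp N y 1) := by
  rw [transverse, Finset.sum_mul_sum, map_sum]
  refine Finset.sum_congr rfl fun x hx => ?_
  rw [map_sum]
  refine Finset.sum_congr rfl fun y hy => ?_
  rw [smul_mul_smul_comm, map_smul, map_mul, spinOp_eq_incl hx, spinOp_eq_incl hy]

/-- Every pair is translated to have first site `x₀`, and the staggering signs disappear in absolute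
value. The free base point is what gives the theorem at every site. -/
lemma transverse_sq_re_le {ρ : WeakDual ℂ (QuasiLocalAlgebra d N)}
    (hρ : ∀ x y v : Site d,
      ρ (spinOp N x 1 * spinOp N y 1) = ρ (spinOp N (x + v) 1 * spinOp N (y + v) 1))
    (x₀ : Site d) (R : ℕ) :
    (ρ (incl (box d R) (transverse d N R * transverse d N R))).re ≤
      (2 * R : ℝ) ^ d * ∑ w ∈ cube d (2 * R), ‖ρ (spinOp N x₀ 1 * spinOp N (x₀ + w) 1)‖ := by
  refine le_trans ?_ (sum_box_sub_le (G := fun w => ‖ρ (spinOp N x₀ 1 * spinOp N (x₀ + w) 1)‖)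
    fun w => norm_nonneg _)
  refine (Complex.re_le_norm _).trans ?_
  rw [incl_transverse_mul, map_sum]
  refine norm_sum_le_of_le _ fun x _ => ?_
  rw [map_sum]
  refine norm_sum_le_of_le _ fun y _ => ?_
  rw [map_smul, norm_smul, norm_mul, norm_stagger, norm_stagger, one_mul, one_mul,
    hρ x y (x₀ - x), add_sub_cancel, show y + (x₀ - x) = x₀ + (y - x) by abel]

end Heisenberg

end

/-! ### The limit of vanishing field and the contradiction at large `R`. -/

open Heisenberg in
theorem mainTheorem5 (d N : ℕ) (hd : 3 ≤ d) (hN : 1 ≤ N) (β : ℝ) (hβ : 0 < β)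
    (B : ℕ → ℝ) (hBpos : ∀ n, 0 < B n) (hB : Tendsto B atTop (𝓝 0))
    (ρ : ℕ → WeakDual ℂ (QuasiLocalAlgebra d N)) (hρ : ∀ n, IsEquilibriumState β (B n) (ρ n))
    (ρ₀ : WeakDual ℂ (QuasiLocalAlgebra d N)) (hρ₀ : Tendsto ρ atTop (𝓝 ρ₀))
    (ℓ : ℕ) (hℓ : 1 ≤ ℓ) (m : ℂ)
    (hm : Tendsto (fun n => magnetization ℓ (ρ n)) atTop (𝓝 m)) (hm0 : m ≠ 0) :
    ∀ x : Site d, ¬ ((fun y : Site d => ρ₀ (spinOp N x 1 * spinOp N y 1))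
      =o[comap (fun y => siteDist x y) atTop]
        fun y => siteDist x y ^ (-((d : ℝ) - 2))) := by
  intro x₀ hdecay
  have hev : ∀ X : QuasiLocalAlgebra d N, Tendsto (fun n => ρ n X) atTop (𝓝 (ρ₀ X)) := fun X =>
    ((WeakDual.eval_continuous X).tendsto ρ₀).comp hρ₀
  have htrans : ∀ x y v : Site d,
      ρ₀ (spinOp N x 1 * spinOp N y 1) = ρ₀ (spinOp N (x + v) 1 * spinOp N (y + v) 1) :=
    fun x y v => tendsto_nhds_unique (hev _)
      ((hev _).congr fun n => ((hρ n).spinOp_one_mul_add x y v).symm)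
  have hmag : Tendsto (fun n => ρ n (spinOp N 0 2)) atTop (𝓝 m) :=
    hm.congr fun n => (hρ n).magnetization_eq hℓ
  obtain ⟨κ, hκ, hS⟩ := exists_norm_siteSpin_le N
  -- `B n → 0` at fixed `R` removes the field term of order `R ^ d`.
  have hbound : ∀ R : ℕ, 1 ≤ R → ((2 * R : ℝ) ^ d) ^ 2 * ‖m‖ ^ 2 ≤
      2 * β * (ρ₀ (incl (box d R) (transverse d N R * transverse d N R))).re *
        (6 * κ ^ 4 * (4 * d * (4 * R : ℝ) ^ d / R ^ 2)) := by
    intro R hR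
    have hBabs : Tendsto (fun n => |B n|) atTop (𝓝 0) := by simpa using hB.abs
    have hlim := (((Complex.continuous_re.tendsto _).comp
      (hev (incl (box d R) (transverse d N R * transverse d N R)))).const_mul (2 * β)).mul
      ((hBabs.mul_const (κ * (4 * R : ℝ) ^ d)).const_add
        (6 * κ ^ 4 * (4 * d * (4 * R : ℝ) ^ d / R ^ 2)))
    rw [zero_mul, add_zero] at hlim
    exact le_of_tendsto_of_tendsto' ((hmag.norm.pow 2).const_mul _) hlim
      fun n => (hρ n).norm_spinOp_two_sq_le hβ.le hκ (hS d) hR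
  obtain ⟨k, rfl⟩ : ∃ k, d = k + 2 := ⟨d - 2, by omega⟩
  have hk : k ≠ 0 := by omega
  have hm2 : 0 < ‖m‖ ^ 2 := by positivity
  set D : ℝ := 2 * (k + 2) * 3 ^ (k + 1) with hD
  have hDpos : 0 < D := by positivity
  set K : ℝ := 2 * β * (6 * κ ^ 4 * (4 * ((k + 2 : ℕ) : ℝ) * 2 ^ (k + 2))) with hK
  have hK0 : 0 ≤ K := by positivity
  -- Chosen so that the far part costs at most half of `‖m‖ ^ 2`; the 4 comes from `(2 * R) ^ 2`,
  -- and `K + 1` avoids division by a possibly zero `K`.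
  set ε : ℝ := ‖m‖ ^ 2 / (2 * (K + 1) * (4 * D)) with hε
  have hεpos : 0 < ε := by positivity
  have hfar : ∃ r : ℕ, ∀ w : Site (k + 2), (r : ℝ) < ‖w‖ →
      ‖ρ₀ (spinOp N x₀ 1 * spinOp N (x₀ + w) 1)‖ ≤ ε * (‖w‖ ^ k)⁻¹ := by
    have h := (isLittleO_iff.1 hdecay) hεpos
    rw [eventually_comap] at h
    obtain ⟨b, hb⟩ := eventually_atTop.1 h
    obtain ⟨r, hr⟩ := exists_nat_ge b
    refine ⟨r, fun w hw => ?_⟩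
    have hw0 : 0 < ‖w‖ := (Nat.cast_nonneg r).trans_lt hw
    have hdist : ‖w‖ ≤ siteDist x₀ (x₀ + w) := by
      have := norm_sub_le_siteDist x₀ (x₀ + w)
      rwa [sub_add_cancel_left, norm_neg] at this
    have hs := hw0.trans_le hdist
    -- The Euclidean distance dominates the sup norm, so the decaying power only grows when the
    -- former is replaced by the latter.
    refine (hb _ (hr.trans (hw.le.trans hdist)) _ rfl).trans
      (mul_le_mul_of_nonneg_left ?_ hεpos.le)
    rw [Real.norm_of_nonneg (Real.rpow_nonneg hs.le _), Real.rpow_neg hs.le,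
      show (((k + 2 : ℕ) : ℝ) - 2) = (k : ℝ) by push_cast; ring, Real.rpow_natCast]
    gcongr
  obtain ⟨r, hr⟩ := hfar
  set M := ∑ w ∈ cube (k + 2) r, ‖ρ₀ (spinOp N x₀ 1 * spinOp N (x₀ + w) 1)‖
  have hfinal : ∀ R : ℕ, 1 ≤ R → (R : ℝ) ^ 2 * ‖m‖ ^ 2 ≤ K * (M + ε * (D * (2 * R) ^ 2)) := by
    intro R hR
    have hR' : (0 : ℝ) < R := by exact_mod_cast hR
    have h1 := transverse_sq_re_le htrans x₀ R
    have h2 := sum_cube_le_of_decay hk (fun w => norm_nonneg _) hεpos.le hr (2 * R)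
    push_cast at h2
    set P : ℝ := (2 * R : ℝ) ^ (k + 2) with hP
    have hPpos : 0 < P := by positivity
    have h3 := h1.trans (mul_le_mul_of_nonneg_left h2 hPpos.le)
    have h4 := (hbound R hR).trans (mul_le_mul_of_nonneg_right
      (mul_le_mul_of_nonneg_left h3 (by positivity : (0 : ℝ) ≤ 2 * β)) (by positivity))
    have h5 : (4 * R : ℝ) ^ (k + 2) = 2 ^ (k + 2) * P := by rw [hP, ← mul_pow]; ring
    rw [h5] at h4
    -- One factor `P` counts base points and the other comes from the double commutator; both cancel
    -- against the squared volume.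
    have h6 : P ^ 2 / R ^ 2 * ((R : ℝ) ^ 2 * ‖m‖ ^ 2) ≤
        P ^ 2 / R ^ 2 * (K * (M + ε * (D * (2 * R) ^ 2))) := by
      refine le_trans (le_of_eq ?_) (h4.trans (le_of_eq ?_))
      · rw [← hP]; field_simp
      · rw [hK]; ring
    exact le_of_mul_le_mul_left h6 (by positivity)
  have hεK : K * (ε * (D * 4)) ≤ ‖m‖ ^ 2 / 2 := by
    have : ε * (D * 4) = ‖m‖ ^ 2 / 2 / (K + 1) := by rw [hε]; field_simp
    rw [this, mul_div_assoc', div_le_iff₀ (by positivity)]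
    nlinarith
  -- After absorbing the far part, `R ^ 2 * ‖m‖ ^ 2 ≤ 2 * (K * M)` remains, whereas this `R > 1`
  -- gives `R ^ 2 * ‖m‖ ^ 2 ≥ R * ‖m‖ ^ 2 > 2 * (K * M)`.
  obtain ⟨R, hR⟩ := exists_nat_gt (max 1 (2 * (K * M) / ‖m‖ ^ 2))
  have hR1 : (1 : ℝ) < R := (le_max_left _ _).trans_lt hR
  have hR2 := (le_max_right _ _).trans_lt hR
  rw [div_lt_iff₀ hm2] at hR2
  have h := hfinal R (by exact_mod_cast hR1.le)
  have h' : (R : ℝ) ^ 2 * (K * (ε * (D * 4))) ≤ (R : ℝ) ^ 2 * (‖m‖ ^ 2 / 2) :=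
    mul_le_mul_of_nonneg_left hεK (sq_nonneg _)
  have h'' : (R : ℝ) * ‖m‖ ^ 2 ≤ (R : ℝ) ^ 2 * ‖m‖ ^ 2 :=
    mul_le_mul_of_nonneg_right (by nlinarith) hm2.le
  nlinarith
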